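/- **Definitions.** A *planar rectilinear drawing* of a graph places its vertices at distinct points of the plane and draws every edge as a horizontal or vertical segment, so that two edges meet only in common end-vertices. A *rectilinear representation* $H$ of a connected graph is given by prescribing for every edge $(a,b)$ whether $a$ lies to the left of, to the right of, below or above $b$, such that at least one planar rectilinear drawing with these directions exists; these drawings are the *drawings of $H$*. $H$ is *convex* if in its drawings every internal face is a rectangle and the external face is bounded by an orthoconvex polygon, i.e. one that meets every horizontal or vertical line in the empty set or in a single segment. The directed multigraph $D_x$ is obtained from $H$ by orienting the horizontal edges from left to right and contracting every maximal path of vertical edges into a node; $D_y$ is obtained by orienting the vertical edges upwards and contracting the maximal paths of horizontal edges. A directed multigraph is *series-parallel* if it arises from single edges $(s,t)$ by series and parallel compositions. A drawing is *greedy* if for all vertices $a,b$ there is a path from $a$ to $b$ along which the Euclidean distance to $b$ strictly decreases at every step. The *area* of a drawing is the area of its bounding box. For $q\ge 2$ let the *staircase* $H_q$ be given by the $n=4q-2$ vertices $v_1,\dots,v_q$, $w_1,\dots,w_{q-1}$, $z_1,\dots,z_q$, $u_2,\dots,u_q$ and the following paths: the vertical path $v_1,\dots,v_q$ (from bottom to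 top), the horizontal paths (from left to right) $w_1,z_1,v_1$; $u_i,w_i,z_i,v_i$ for $2\le i\le q-1$; $u_q,z_q,v_q$; and the vertical edges $(w_i,u_{i+1})$ with $u_{i+1}$ above $w_i$, for $1\le i\le q-1$. **Theorem.** There is a constant $c>0$ such that for every $q\ge 2$: 1. $H_q$ is a convex rectilinear representation of a biconnected graph with $n=4q-2$ vertices, both $D_x$ and $D_y$ are series-parallel, and $H_q$ has a greedy rectilinear drawing with integer coordinates. 2. In every greedy rectilinear drawing of $H_q$, with $d(a)=x(v_1)-x(a)$, one has $d(z_i)>2\,d(w_{i+1})$ for $1\le i\le q-2$ (hence $d(z_i)>2\,d(z_{i+1})$), and $d(z_{q-1})>2\,d(z_q)$ or $d(z_q)>2\,d(z_{q-1})$. 3. Every greedy rectilinear drawing of $H_q$ in which any two vertices have distance at least $1$ (in particular, every one on the integer grid) has area at least $2^{cn}$. In particular, there are convex rectilinear representations with series-parallel $D_x$ and $D_y$ all of whose greedy rectilinear drawings have area $2^{\Omega(n)}$. -/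

import Mathlib

noncomputable section

/-- A directed multigraph with node type `N` and edge type `E`. -/
structure MultiDigraph (N E : Type) where
  src : E → N
  tgt : E → N

namespace MultiDigraph

variable {N E : Type} (D : MultiDigraph N E)

/-- The nodes incident to an edge of `A`. -/
def nodes (A : Set E) : Set N := D.src '' A ∪ D.tgt '' A

/-- `D.SPPart A s t`: the subgraph of `D` formed by the edges in `A` and their end-nodes is a
series-parallel digraph with source `s` and sink `t`. A parallel composition glues two parts that
have exactly the source and the sink in common, a series composition glues two parts that have
exactly the sink of the first, which is the source of the second, in common. Compositions of more
than two parts are iterated binary ones. -/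
inductive SPPart : Set E → N → N → Prop
  | edge (e : E) (h : D.src e ≠ D.tgt e) : SPPart {e} (D.src e) (D.tgt e)
  | parallel {A B : Set E} {s t : N} (hA : SPPart A s t) (hB : SPPart B s t)
      (hE : Disjoint A B) (hN : D.nodes A ∩ D.nodes B = {s, t}) : SPPart (A ∪ B) s t
  | series {A B : Set E} {s m t : N} (hA : SPPart A s m) (hB : SPPart B m t)
      (hE : Disjoint A B) (hN : D.nodes A ∩ D.nodes B = {m}) : SPPart (A ∪ B) s t

/-- `D` is series-parallel. -/
def IsSeriesParallel : Prop :=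
  D.nodes Set.univ = Set.univ ∧ ∃ s t : N, D.SPPart Set.univ s t

end MultiDigraph

/-- A graph is biconnected if it has at least three vertices, is connected, and has no
cutvertex. -/
def SimpleGraph.IsBiconnected {V : Type} (G : SimpleGraph V) : Prop :=
  3 ≤ ENat.card V ∧ G.Connected ∧ ∀ v : V, (G.induce {v}ᶜ).Connected

/-- The Euclidean plane; `P 0` is the `x`-coordinate of `P` and `P 1` its `y`-coordinate. -/
abbrev Plane : Type := EuclideanSpace ℝ (Fin 2)

/-- A graph whose edges carry an orientation: `right u v` says that there is a horizontal edge
between `u` and `v` with `v` to the right of `u`, and `up u v` says that there is a vertical edge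
between `u` and `v` with `v` above `u`. -/
structure OrientedShape (V : Type) where
  right : V → V → Prop
  up : V → V → Prop

namespace OrientedShape

variable {V : Type} (H : OrientedShape V)

/-- The underlying undirected graph. -/
def graph : SimpleGraph V := SimpleGraph.fromRel fun u v => H.right u v ∨ H.up u v

/-- The planar rectilinear drawings with straight-line edges of the prescribed directions, given
by the positions of the vertices. The directions fix the cyclic order of the edges at each vertex
and all angles. -/
structure IsDrawing (p : V → Plane) : Prop where
  injective : Function.Injective p
  right_edge : ∀ u v, H.right u v → p u 1 = p v 1 ∧ p u 0 < p v 0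
  up_edge : ∀ u v, H.up u v → p u 0 = p v 0 ∧ p u 1 < p v 1
  /-- Distinct edges meet only in common end-vertices. -/
  planar : ∀ a b c d, H.graph.Adj a b → H.graph.Adj c d → s(a, b) ≠ s(c, d) →
    ∀ P ∈ segment ℝ (p a) (p b) ∩ segment ℝ (p c) (p d),
      ∃ w, w ∈ s(a, b) ∧ w ∈ s(c, d) ∧ P = p w

/-- `H` is a rectilinear representation of a connected plane graph, i.e. a class of planar
rectilinear drawings: it has a drawing. (For a connected graph the directions of the edges
determine the faces, including the external one, hence the plane embedding and the angles.) -/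
def IsRectilinearRepresentation : Prop :=
  H.graph.Connected ∧ ∃ p : V → Plane, H.IsDrawing p

/-- The points covered by the edges of a drawing. -/
def drawn (p : V → Plane) : Set Plane :=
  {P | ∃ u v, H.graph.Adj u v ∧ P ∈ segment ℝ (p u) (p v)}

/-- The faces of a drawing: the connected components of the complement of the drawn graph. -/
def IsFace (p : V → Plane) (F : Set Plane) : Prop :=
  ∃ P ∈ (H.drawn p)ᶜ, F = connectedComponentIn (H.drawn p)ᶜ P

/-- `H`, a rectilinear representation of a biconnected graph, is convex: in its drawings, every
internal (bounded) face is a rectangle, and the region `Fᶜ` enclosed by the boundary of the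
external (unbounded) face `F`, which is a simple polygon as the graph is biconnected, is
orthoconvex: it meets every vertical and every horizontal line in the empty set or in a single
segment. -/
def IsConvex : Prop :=
  ∀ p : V → Plane, H.IsDrawing p → ∀ F : Set Plane, H.IsFace p F →
    (Bornology.IsBounded F → ∃ a b c d : ℝ, a < b ∧ c < d ∧
      F = {P : Plane | a < P 0 ∧ P 0 < b ∧ c < P 1 ∧ P 1 < d}) ∧
    (¬ Bornology.IsBounded F → ∀ t : ℝ,
      Convex ℝ {P : Plane | P ∉ F ∧ P 0 = t} ∧ Convex ℝ {P : Plane | P ∉ F ∧ P 1 = t})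

/-- The subgraph of the vertical edges; its components are the maximal vertical paths. -/
def verticalGraph : SimpleGraph V := SimpleGraph.fromRel H.up

/-- The subgraph of the horizontal edges; its components are the maximal horizontal paths. -/
def horizontalGraph : SimpleGraph V := SimpleGraph.fromRel H.right

/-- `D_x`: every maximal vertical path is contracted into a node, and the horizontal edges are
directed from left to right. Multiple edges are kept. -/
def Dx : MultiDigraph H.verticalGraph.ConnectedComponent {e : V × V // H.right e.1 e.2} where
  src e := H.verticalGraph.connectedComponentMk e.1.1
  tgt e := H.verticalGraph.connectedComponentMk e.1.2

/-- `D_y`: every maximal horizontal path is contracted into a node, and the vertical edges are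
directed upwards. Multiple edges are kept. -/
def Dy : MultiDigraph H.horizontalGraph.ConnectedComponent {e : V × V // H.up e.1 e.2} where
  src e := H.horizontalGraph.connectedComponentMk e.1.1
  tgt e := H.horizontalGraph.connectedComponentMk e.1.2

/-- A drawing is greedy if for every ordered pair `u, v` there is a distance-decreasing path from
`u` to `v`. (The strict decrease of the distances makes the walk `W` a path.) -/
def IsGreedyDrawing (p : V → Plane) : Prop :=
  H.IsDrawing p ∧ ∀ u v : V, ∃ W : H.graph.Walk u v, ∀ i < W.length,
    dist (p (W.getVert (i + 1))) (p v) < dist (p (W.getVert i)) (p v)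

end OrientedShape

/-- All vertices lie on the integer grid. -/
def OnIntegerGrid {V : Type} (p : V → Plane) : Prop :=
  ∀ v, ∃ a b : ℤ, p v 0 = a ∧ p v 1 = b

/-- The area of the bounding box of a drawing of a finite graph. -/
def drawingArea {V : Type} (p : V → Plane) : ℝ :=
  ((⨆ v, p v 0) - ⨅ v, p v 0) * ((⨆ v, p v 1) - ⨅ v, p v 1)

/-- The vertices of the staircase with `q = m + 1` rows. With `i` counted from `0`, `v i`, `w i`
and `z i` are the vertices `v_{i+1}`, `w_{i+1}` and `z_{i+1}`, and `u i` is the vertex `u_{i+2}`,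
which lies above `w_{i+1}`. -/
inductive StairVertex (m : ℕ) : Type
  | v (i : Fin (m + 1))
  | w (i : Fin m)
  | z (i : Fin (m + 1))
  | u (i : Fin m)

/-- The horizontal edges of the staircase, from left to right: the rows are `w_1, z_1, v_1`, then
`u_i, w_i, z_i, v_i` for `2 ≤ i ≤ q - 1`, and `u_q, z_q, v_q`. -/
inductive StairRight (m : ℕ) : StairVertex m → StairVertex m → Prop
  | uw (i j : Fin m) (h : (j : ℕ) = i + 1) : StairRight m (.u i) (.w j)
  | uz (i : Fin m) (h : (i : ℕ) + 1 = m) : StairRight m (.u i) (.z (Fin.last m))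
  | wz (i : Fin m) : StairRight m (.w i) (.z i.castSucc)
  | zv (i : Fin (m + 1)) : StairRight m (.z i) (.v i)

/-- The vertical edges of the staircase, upwards: the path `v_1, …, v_q` and the edges from `w_i`
to `u_{i+1}`. -/
inductive StairUp (m : ℕ) : StairVertex m → StairVertex m → Prop
  | vv (i : Fin m) : StairUp m (.v i.castSucc) (.v i.succ)
  | wu (i : Fin m) : StairUp m (.w i) (.u i)

/-- The staircase with `q = m + 1` rows. -/
def staircase (m : ℕ) : OrientedShape (StairVertex m) where
  right := StairRight m
  up := StairUp m

end

/-! Let d be the horizontal distance to the vertical path of the v's, with rows counted from 0 to m.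
All edges at z_i are horizontal, and its left neighbour has the abscissa of some w. So the first
greedy step from z_i towards a target t only compares abscissae: either v_i or that left neighbour
must be closer to t than z_i (`greedy_step_z`).

The last two rows share the column of w_{m-1} as left end, and greedy paths between their z's force
a factor two between the two distances (`greedy_last_rows`). For rows i and j = i+1, suppose d(z_i)
≤ 2 d(w_j). Greedy steps among z_i, w_j and z_j then give 2 d(z_i) < d(z_j). As rows j and j+1 are
already known to differ by a factor two in one direction or the other, some greedy path gets stuck
(`greedy_inner_rows`). Downward induction covers all rows. Since w_i lies left of z_i, d(w_i) more
than doubles with every row downwards. With minimum distance 1 the width is at least 2^m and the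
height at least 1.

For existence, put z_i at distance 4·3^(m-i), and w_i and u_i one unit further left; every vertex
then has a neighbour closer to any given target, which suffices on a finite vertex set. Convexity
holds because every drawing consists of rectangles stacked between consecutive rows, with a common
right side and left sides moving right as the rows go up. D_x is an iterated parallel composition,
D_y a chain of double edges, and biconnectedness comes from two vertical strands joined by the rows.
-/

/-! ### Distances and axis-parallel segments in coordinates. -/

theorem Plane.ext_coords {P Q : Plane} (h0 : P 0 = Q 0) (h1 : P 1 = Q 1) : P = Q := by
  ext i
  fin_cases i
  · exact h0
  · exact h1

theorem Plane.dist_lt_iff (A B T : Plane) : dist A T < dist B T ↔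
    (A 0 - T 0) ^ 2 + (A 1 - T 1) ^ 2 < (B 0 - T 0) ^ 2 + (B 1 - T 1) ^ 2 := by
  rw [EuclideanSpace.dist_eq, EuclideanSpace.dist_eq, Fin.sum_univ_two, Fin.sum_univ_two,
    Real.sqrt_lt_sqrt_iff (by positivity)]
  simp only [Real.dist_eq, sq_abs]

theorem Plane.dist_lt_iff_of_snd_eq {A B : Plane} (T : Plane) (h : A 1 = B 1) :
    dist A T < dist B T ↔ |A 0 - T 0| < |B 0 - T 0| := by
  rw [Plane.dist_lt_iff, h, ← sq_lt_sq]
  exact ⟨fun h => by linarith, fun h => by linarith⟩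

theorem Plane.dist_lt_iff_of_fst_eq {A B : Plane} (T : Plane) (h : A 0 = B 0) :
    dist A T < dist B T ↔ |A 1 - T 1| < |B 1 - T 1| := by
  rw [Plane.dist_lt_iff, h, ← sq_lt_sq]
  exact ⟨fun h => by linarith, fun h => by linarith⟩

theorem Plane.dist_of_snd_eq {A B : Plane} (h : A 1 = B 1) : dist A B = |A 0 - B 0| := by
  rw [EuclideanSpace.dist_eq, Fin.sum_univ_two, h]
  simp [Real.dist_eq, Real.sqrt_sq_eq_abs]

theorem Plane.dist_of_fst_eq {A B : Plane} (h : A 0 = B 0) : dist A B = |A 1 - B 1| := by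
  rw [EuclideanSpace.dist_eq, Fin.sum_univ_two, h]
  simp [Real.dist_eq, Real.sqrt_sq_eq_abs]

theorem Plane.mem_segment_of_snd_eq {A B P : Plane} (h : A 1 = B 1) (h' : A 0 < B 0) :
    P ∈ segment ℝ A B ↔ P 1 = A 1 ∧ A 0 ≤ P 0 ∧ P 0 ≤ B 0 := by
  constructor
  · rintro ⟨a, b, ha, hb, hab, rfl⟩
    have : a = 1 - b := by linarith
    subst this
    simp only [PiLp.add_apply, PiLp.smul_apply, smul_eq_mul]
    refine ⟨by rw [h]; ring, by nlinarith, by nlinarith⟩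
  · rintro ⟨h1, h2, h3⟩
    have hd : (0 : ℝ) < B 0 - A 0 := by linarith
    refine ⟨(B 0 - P 0) / (B 0 - A 0), (P 0 - A 0) / (B 0 - A 0), div_nonneg (by linarith) hd.le,
      div_nonneg (by linarith) hd.le, by field_simp; ring, Plane.ext_coords ?_ ?_⟩
    · simp only [PiLp.add_apply, PiLp.smul_apply, smul_eq_mul]
      field_simp; ring
    · simp only [PiLp.add_apply, PiLp.smul_apply, smul_eq_mul]
      rw [h1, ← h]
      field_simp; ring

theorem Plane.mem_segment_of_fst_eq {A B P : Plane} (h : A 0 = B 0) (h' : A 1 < B 1) :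
    P ∈ segment ℝ A B ↔ P 0 = A 0 ∧ A 1 ≤ P 1 ∧ P 1 ≤ B 1 := by
  constructor
  · rintro ⟨a, b, ha, hb, hab, rfl⟩
    have : a = 1 - b := by linarith
    subst this
    simp only [PiLp.add_apply, PiLp.smul_apply, smul_eq_mul]
    refine ⟨by rw [h]; ring, by nlinarith, by nlinarith⟩
  · rintro ⟨h1, h2, h3⟩
    have hd : (0 : ℝ) < B 1 - A 1 := by linarith
    refine ⟨(B 1 - P 1) / (B 1 - A 1), (P 1 - A 1) / (B 1 - A 1), div_nonneg (by linarith) hd.le,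
      div_nonneg (by linarith) hd.le, by field_simp; ring, Plane.ext_coords ?_ ?_⟩
    · simp only [PiLp.add_apply, PiLp.smul_apply, smul_eq_mul]
      rw [h1, ← h]
      field_simp; ring
    · simp only [PiLp.add_apply, PiLp.smul_apply, smul_eq_mul]
      field_simp; ring

/-! ### Local criteria for planar and for greedy drawings. -/

namespace OrientedShape

variable {V : Type} {H : OrientedShape V} {p : V → Plane}

theorem graph_adj {a b : V} : H.graph.Adj a b ↔
    a ≠ b ∧ ((H.right a b ∨ H.up a b) ∨ (H.right b a ∨ H.up b a)) := by
  simp [graph, SimpleGraph.fromRel_adj]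

/-- A drawing is planar if no vertex lies inside an edge and horizontal edges meet vertical ones
only in vertices. -/
theorem isDrawing_of_forall (hinj : Function.Injective p)
    (hr : ∀ u v, H.right u v → p u 1 = p v 1 ∧ p u 0 < p v 0)
    (hu : ∀ u v, H.up u v → p u 0 = p v 0 ∧ p u 1 < p v 1)
    (hvert : ∀ a b c, H.right a b ∨ H.up a b → p c ∈ segment ℝ (p a) (p b) → c = a ∨ c = b)
    (hcross : ∀ a b c d, H.right a b → H.up c d →
      ∀ P ∈ segment ℝ (p a) (p b) ∩ segment ℝ (p c) (p d), ∃ w, P = p w) :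
    H.IsDrawing p := by
  refine ⟨hinj, hr, hu, ?_⟩
  have common : ∀ a b c d, (H.right a b ∨ H.up a b) → (H.right c d ∨ H.up c d) →
      ∀ w, p w ∈ segment ℝ (p a) (p b) ∩ segment ℝ (p c) (p d) →
        ∃ w', w' ∈ s(a, b) ∧ w' ∈ s(c, d) ∧ p w = p w' := fun a b c d h h' w hw =>
    ⟨w, by simpa using hvert a b w h hw.1, by simpa using hvert c d w h' hw.2, rfl⟩
  have overlap : ∀ a b c d, H.right a b ∨ H.up a b → H.right c d ∨ H.up c d →
      s(a, b) ≠ s(c, d) → ∀ i j : Fin 2,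
      (∀ Q : Plane, Q ∈ segment ℝ (p a) (p b) ↔ Q j = p a j ∧ p a i ≤ Q i ∧ Q i ≤ p b i) →
      (∀ Q : Plane, Q ∈ segment ℝ (p c) (p d) ↔ Q j = p c j ∧ p c i ≤ Q i ∧ Q i ≤ p d i) →
      p a j = p b j → p c j = p d j → (∀ P Q : Plane, P i = Q i → P j = Q j → P = Q) →
      ∀ P ∈ segment ℝ (p a) (p b) ∩ segment ℝ (p c) (p d),
      ∃ w, w ∈ s(a, b) ∧ w ∈ s(c, d) ∧ P = p w := by
    intro a b c d h1 h2 hne i j m1 m2 e1 e2 hext P hP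
    have hP' := hP
    obtain ⟨hP1, hP2⟩ := hP
    rw [m1] at hP1
    rw [m2] at hP2
    by_cases hw : ∃ w, P = p w
    · obtain ⟨w, rfl⟩ := hw
      exact common a b c d h1 h2 w hP'
    · push Not at hw
      have na : p a i < P i := lt_of_le_of_ne hP1.2.1 fun h =>
        hw a (hext _ _ h.symm hP1.1)
      have nb : P i < p b i := lt_of_le_of_ne hP1.2.2 fun h =>
        hw b (hext _ _ h (hP1.1.trans e1))
      have nc : p c i < P i := lt_of_le_of_ne hP2.2.1 fun h =>
        hw c (hext _ _ h.symm hP2.1)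
      have nd : P i < p d i := lt_of_le_of_ne hP2.2.2 fun h =>
        hw d (hext _ _ h (hP2.1.trans e2))
      have eac : p a j = p c j := hP1.1.symm.trans hP2.1
      -- P is interior to both parallel edges, so the later of the two left (or lower) ends lies on
      -- the other edge. It is a vertex there, hence an end-vertex, which makes the two ends
      -- coincide. The other pair of ends is treated alike.
      have hac : a = c := by
        rcases le_total (p a i) (p c i) with h | h
        · rcases hvert a b c h1 ((m1 _).2 ⟨eac.symm, h, by linarith⟩) with h | h
          · exact h.symm
          · rw [h] at nc; linarith
        · rcases hvert c d a h2 ((m2 _).2 ⟨eac, h, by linarith⟩) with h | h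
          · exact h
          · rw [h] at na; linarith
      have hbd : b = d := by
        rcases le_total (p b i) (p d i) with h | h
        · rcases hvert c d b h2 ((m2 _).2 ⟨by rw [← e1, eac], by linarith, h⟩) with h | h
          · rw [h] at nb; linarith
          · exact h
        · rcases hvert a b d h1 ((m1 _).2 ⟨by rw [← e2, eac], by linarith, h⟩) with h | h
          · rw [h] at nd; linarith
          · exact h.symm
      exact absurd (by rw [hac, hbd]) hne
  have main : ∀ a b c d, (H.right a b ∨ H.up a b) → (H.right c d ∨ H.up c d) →
      s(a, b) ≠ s(c, d) → ∀ P ∈ segment ℝ (p a) (p b) ∩ segment ℝ (p c) (p d),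
      ∃ w, w ∈ s(a, b) ∧ w ∈ s(c, d) ∧ P = p w := by
    intro a b c d h1 h2 hne P hP
    rcases id h1 with r1 | r1 <;> rcases id h2 with r2 | r2
    · exact overlap a b c d h1 h2 hne 0 1
        (fun Q => Plane.mem_segment_of_snd_eq (hr a b r1).1 (hr a b r1).2)
        (fun Q => Plane.mem_segment_of_snd_eq (hr c d r2).1 (hr c d r2).2)
        (hr a b r1).1 (hr c d r2).1 (fun P Q h h' => Plane.ext_coords h h') P hP
    · obtain ⟨w, rfl⟩ := hcross a b c d r1 r2 P hP
      exact common a b c d h1 h2 w hP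
    · obtain ⟨w, rfl⟩ := hcross c d a b r2 r1 P hP.symm
      exact common a b c d h1 h2 w hP
    · exact overlap a b c d h1 h2 hne 1 0
        (fun Q => Plane.mem_segment_of_fst_eq (hu a b r1).1 (hu a b r1).2)
        (fun Q => Plane.mem_segment_of_fst_eq (hu c d r2).1 (hu c d r2).2)
        (hu a b r1).1 (hu c d r2).1 (fun P Q h h' => Plane.ext_coords h' h) P hP
  intro a b c d hab hcd hne P hP
  rcases (graph_adj.1 hab).2 with h1 | h1 <;> rcases (graph_adj.1 hcd).2 with h2 | h2
  · exact main a b c d h1 h2 hne P hP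
  · rw [Sym2.eq_swap (a := c)] at hne ⊢
    rw [segment_symm ℝ (p c)] at hP
    exact main a b d c h1 h2 hne P hP
  · rw [Sym2.eq_swap (a := a)] at hne ⊢
    rw [segment_symm ℝ (p a)] at hP
    exact main b a c d h1 h2 hne P hP
  · rw [Sym2.eq_swap (a := a), Sym2.eq_swap (a := c)] at hne ⊢
    rw [segment_symm ℝ (p a), segment_symm ℝ (p c)] at hP
    exact main b a d c h1 h2 hne P hP

theorem IsGreedyDrawing.exists_adj_closer (hp : H.IsGreedyDrawing p) {a b : V} (hab : a ≠ b) :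
    ∃ c, H.graph.Adj a c ∧ dist (p c) (p b) < dist (p a) (p b) := by
  obtain ⟨W, hW⟩ := hp.2 a b
  have hlen : 0 < W.length := by
    by_contra h
    exact hab (SimpleGraph.Walk.eq_of_length_eq_zero (p := W) (by omega))
  have h := hW 0 hlen
  have hadj := W.adj_getVert_succ hlen
  rw [SimpleGraph.Walk.getVert_zero] at h hadj
  exact ⟨_, hadj, h⟩

/-- On a finite vertex set the distance to the target is well-founded, so closer neighbours can be
followed until the target is reached. -/
theorem isGreedyDrawing_of_exists_adj_closer [Finite V] (hp : H.IsDrawing p)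
    (h : ∀ a b, a ≠ b → ∃ c, H.graph.Adj a c ∧ dist (p c) (p b) < dist (p a) (p b)) :
    H.IsGreedyDrawing p := by
  refine ⟨hp, fun a b => ?_⟩
  let r : V → V → Prop := fun c a => dist (p c) (p b) < dist (p a) (p b)
  have : IsTrans V r := ⟨fun _ _ _ h h' => lt_trans h h'⟩
  have : Std.Irrefl r := ⟨fun _ => lt_irrefl _⟩
  have hwf : WellFounded r := Finite.wellFounded_of_trans_of_irrefl r
  induction a using hwf.induction with
  | _ a ih =>
    by_cases hab : a = b
    · subst hab
      exact ⟨.nil, fun i hi => absurd hi (by simp)⟩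
    · obtain ⟨c, hac, hc⟩ := h a b hab
      obtain ⟨W, hW⟩ := ih c hc
      refine ⟨.cons hac W, fun i hi => ?_⟩
      rcases i with _ | i
      · simpa using hc
      · simpa using hW i (by simpa using hi)

end OrientedShape

/-! ### Series-parallel digraphs under renaming of nodes. -/

namespace MultiDigraph

variable {N N' E : Type} (D : MultiDigraph N E)

/-- Rename the nodes along a map. -/
def mapNodes (g : N → N') : MultiDigraph N' E where
  src e := g (D.src e)
  tgt e := g (D.tgt e)

theorem nodes_mapNodes (g : N → N') (A : Set E) : (D.mapNodes g).nodes A = g '' D.nodes A := by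
  simp only [nodes, Set.image_union, Set.image_image]
  rfl

theorem nodes_union (A B : Set E) : D.nodes (A ∪ B) = D.nodes A ∪ D.nodes B := by
  simp only [nodes, Set.image_union]
  exact Set.union_union_union_comm _ _ _ _

theorem nodes_singleton (e : E) : D.nodes {e} = {D.src e, D.tgt e} := by
  rw [nodes, Set.image_singleton, Set.image_singleton, Set.singleton_union]

variable {D}

theorem SPPart.endpoints_mem {A : Set E} {s t : N} (h : D.SPPart A s t) :
    s ∈ D.nodes A ∧ t ∈ D.nodes A := by
  induction h with
  | edge e h => simp [nodes_singleton]
  | parallel hA hB hE hN ihA ihB => exact ⟨by simp [nodes_union, ihA], by simp [nodes_union, ihA]⟩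
  | series hA hB hE hN ihA ihB => exact ⟨by simp [nodes_union, ihA], by simp [nodes_union, ihB]⟩

/-- The compositions depend only on which nodes coincide, and an injective map preserves and
reflects this. It transfers decompositions from explicit labels back to connected components. -/
theorem SPPart.of_mapNodes {g : N → N'} (hg : Function.Injective g) {A : Set E} {s' t' : N'}
    (h : (D.mapNodes g).SPPart A s' t') : ∃ s t, g s = s' ∧ g t = t' ∧ D.SPPart A s t := by
  induction h with
  | edge e h => exact ⟨_, _, rfl, rfl, .edge e fun h' => h (congrArg g h')⟩
  | parallel hA hB hE hN ihA ihB =>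
    obtain ⟨s, t, rfl, rfl, h1⟩ := ihA
    obtain ⟨s2, t2, hs, ht, h2⟩ := ihB
    obtain rfl := hg hs
    obtain rfl := hg ht
    refine ⟨_, _, rfl, rfl, .parallel h1 h2 hE (hg.image_injective ?_)⟩
    rw [Set.image_inter hg, ← nodes_mapNodes, ← nodes_mapNodes, hN, Set.image_pair]
  | series hA hB hE hN ihA ihB =>
    obtain ⟨s, t, rfl, rfl, h1⟩ := ihA
    obtain ⟨s2, t2, hs, rfl, h2⟩ := ihB
    obtain rfl := hg hs
    refine ⟨_, _, rfl, rfl, .series h1 h2 hE (hg.image_injective ?_)⟩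
    rw [Set.image_inter hg, ← nodes_mapNodes, ← nodes_mapNodes, hN, Set.image_singleton]

theorem SPPart.edge_of_eq {e : E} {s t : N} (hs : D.src e = s) (ht : D.tgt e = t) (h : s ≠ t) :
    D.SPPart {e} s t := by
  subst hs ht
  exact .edge e h

end MultiDigraph

/-! ### Reachability after deleting a vertex, and labels of components. -/

namespace SimpleGraph

variable {V : Type} {G : SimpleGraph V}

/-- `a` and `b` are connected in the graph obtained by deleting `x`. -/
def ReachableAvoiding (G : SimpleGraph V) (x a b : V) : Prop :=
  ∃ (ha : a ≠ x) (hb : b ≠ x), (G.induce {x}ᶜ).Reachable ⟨a, ha⟩ ⟨b, hb⟩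

theorem ReachableAvoiding.refl {x a : V} (ha : a ≠ x) : G.ReachableAvoiding x a a :=
  ⟨ha, ha, Reachable.refl _⟩

theorem ReachableAvoiding.symm {x a b : V} (h : G.ReachableAvoiding x a b) :
    G.ReachableAvoiding x b a :=
  ⟨h.2.1, h.1, h.2.2.symm⟩

theorem ReachableAvoiding.trans {x a b c : V} (h : G.ReachableAvoiding x a b)
    (h' : G.ReachableAvoiding x b c) : G.ReachableAvoiding x a c :=
  ⟨h.1, h'.2.1, h.2.2.trans h'.2.2⟩

theorem Adj.reachableAvoiding {x a b : V} (h : G.Adj a b) (ha : a ≠ x) (hb : b ≠ x) :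
    G.ReachableAvoiding x a b :=
  ⟨ha, hb, Adj.reachable (G := G.induce {x}ᶜ) (by simpa using h)⟩

theorem connected_induce_compl_singleton {x : V} (r : V) (hr : r ≠ x)
    (h : ∀ a, a ≠ x → G.ReachableAvoiding x a r) : (G.induce {x}ᶜ).Connected :=
  connected_iff_exists_forall_reachable _ |>.2
    ⟨⟨r, hr⟩, fun a => (h a.1 a.2).2.2.symm⟩

theorem ConnectedComponent.exists_injective_label {L : Type} (f : V → L)
    (hadj : ∀ a b, G.Adj a b → f a = f b) (hf : ∀ a b, f a = f b → G.Reachable a b) :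
    ∃ g : G.ConnectedComponent → L, Function.Injective g ∧
      ∀ a, g (G.connectedComponentMk a) = f a := by
  have walk : ∀ {a b : V} (W : G.Walk a b), f a = f b := by
    intro a b W
    induction W with
    | nil => rfl
    | cons h _ ih => exact (hadj _ _ h).trans ih
  refine ⟨ConnectedComponent.lift f fun a b W _ => walk W, fun c d => ?_, fun _ => rfl⟩
  induction c using ConnectedComponent.ind with | _ a
  induction d using ConnectedComponent.ind with | _ b
  exact fun h => ConnectedComponent.sound (hf a b h)

end SimpleGraph

/-! ### Vertices and adjacencies of the staircase. -/

namespace StairVertex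

/-- The staircase vertices as a sum type. -/
def equivSum (m : ℕ) :
    StairVertex m ≃ (Fin (m + 1) ⊕ Fin m) ⊕ (Fin (m + 1) ⊕ Fin m) where
  toFun
    | v i => .inl (.inl i)
    | w i => .inl (.inr i)
    | z i => .inr (.inl i)
    | u i => .inr (.inr i)
  invFun
    | .inl (.inl i) => v i
    | .inl (.inr i) => w i
    | .inr (.inl i) => z i
    | .inr (.inr i) => u i
  left_inv a := by cases a <;> rfl
  right_inv a := by rcases a with (a | a) | (a | a) <;> rfl

instance (m : ℕ) : Finite (StairVertex m) := Finite.of_equiv _ (equivSum m).symm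

theorem natCard (m : ℕ) : Nat.card (StairVertex m) = 4 * m + 2 := by
  rw [Nat.card_congr (equivSum m)]
  simp
  omega

end StairVertex

section Adjacency

variable {m : ℕ}

theorem staircase_adj_of_right {a b : StairVertex m} (h : StairRight m a b) :
    (staircase m).graph.Adj a b := by
  refine OrientedShape.graph_adj.2 ⟨?_, .inl (.inl h)⟩
  rintro rfl
  cases h

theorem staircase_adj_of_up {a b : StairVertex m} (h : StairUp m a b) :
    (staircase m).graph.Adj a b := by
  refine OrientedShape.graph_adj.2 ⟨?_, .inl (.inr h)⟩
  cases h with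
  | vv i => simpa using i.castSucc_lt_succ.ne
  | wu i => simp

/-- The successor of `u i` in its row. -/
def StairVertex.next (i : Fin m) : StairVertex m :=
  if h : (i : ℕ) + 1 < m then .w ⟨i + 1, h⟩ else .z (Fin.last m)

theorem stairRight_next (i : Fin m) : StairRight m (.u i) (.next i) := by
  unfold StairVertex.next
  split_ifs with h
  · exact .uw _ _ rfl
  · exact .uz _ (by omega)

theorem stairRight_u_iff {i : Fin m} {b : StairVertex m} :
    StairRight m (.u i) b ↔ b = .next i := by
  constructor
  · intro h
    unfold StairVertex.next
    cases h with
    | uw i j h =>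
      rw [dif_pos (by omega)]
      exact congrArg _ (Fin.ext h)
    | uz i h => rw [dif_neg (by omega)]
  · rintro rfl
    exact stairRight_next i

theorem staircase_adj_zv (i : Fin (m + 1)) : (staircase m).graph.Adj (.z i) (.v i) :=
  staircase_adj_of_right (.zv i)

theorem staircase_adj_wz (i : Fin m) : (staircase m).graph.Adj (.w i) (.z i.castSucc) :=
  staircase_adj_of_right (.wz i)

theorem staircase_adj_next (i : Fin m) : (staircase m).graph.Adj (.u i) (.next i) :=
  staircase_adj_of_right (stairRight_next i)

theorem staircase_adj_vv (i : Fin m) :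
    (staircase m).graph.Adj (.v i.castSucc) (.v i.succ) :=
  staircase_adj_of_up (.vv i)

theorem staircase_adj_wu (i : Fin m) : (staircase m).graph.Adj (.w i) (.u i) :=
  staircase_adj_of_up (.wu i)

end Adjacency

/-! ### Biconnectedness. -/

section Connectivity

variable {m : ℕ}

open StairVertex

theorem staircase_connected (m : ℕ) : (staircase m).graph.Connected := by
  rw [SimpleGraph.connected_iff_exists_forall_reachable]
  refine ⟨v 0, ?_⟩
  have hv : ∀ i, (staircase m).graph.Reachable (v 0) (v i) := by
    intro i
    induction i using Fin.induction with
    | zero => rfl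
    | succ i ih => exact ih.trans (staircase_adj_vv i).reachable
  have hz : ∀ i, (staircase m).graph.Reachable (v 0) (z i) := fun i =>
    (hv i).trans (staircase_adj_zv i).symm.reachable
  have hw : ∀ i, (staircase m).graph.Reachable (v 0) (w i) := fun i =>
    (hz _).trans (staircase_adj_wz i).symm.reachable
  rintro (i | i | i | i)
  · exact hv i
  · exact hw i
  · exact hz i
  · exact (hw i).trans (staircase_adj_wu i).reachable

theorem reachableAvoiding_v {x : StairVertex m} (hx : ∀ i, v i ≠ x) (i : Fin (m + 1)) :
    (staircase m).graph.ReachableAvoiding x (v i) (v 0) := by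
  induction i using Fin.induction with
  | zero => exact .refl (hx 0)
  | succ i ih => exact ((staircase_adj_vv i).symm.reachableAvoiding (hx _) (hx _)).trans ih

theorem reachableAvoiding_z {x : StairVertex m} (hx : ∀ i, v i ≠ x) {i : Fin (m + 1)}
    (hi : z i ≠ x) : (staircase m).graph.ReachableAvoiding x (z i) (v 0) :=
  ((staircase_adj_zv i).reachableAvoiding hi (hx i)).trans (reachableAvoiding_v hx i)

/-- The left boundary is a path w_0, u_0, w_1, u_1, ..., intact as long as no w and no u is deleted.
-/
theorem reachableAvoiding_w_zero (hm : 0 < m) {x : StairVertex m} (hw : ∀ i, w i ≠ x)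
    (hu : ∀ i, u i ≠ x) (i : Fin m) :
    (staircase m).graph.ReachableAvoiding x (w i) (w ⟨0, hm⟩) := by
  obtain ⟨i, hi⟩ := i
  induction i with
  | zero => exact .refl (hw _)
  | succ i ih =>
    have h := ((staircase_adj_wu ⟨i, by omega⟩).reachableAvoiding (hw _) (hu _)).symm.trans
      (ih (by omega))
    have h' := staircase_adj_next (m := m) ⟨i, by omega⟩
    rw [next, dif_pos hi] at h'
    exact (h'.symm.reachableAvoiding (hw _) (hu _)).trans h

/-- The path of the v's is cut, so the left boundary serves as the hub; every row still hangs on it.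
-/
theorem staircase_connected_delete_v (hm : 0 < m) (k : Fin (m + 1)) :
    ((staircase m).graph.induce {v k}ᶜ).Connected := by
  refine SimpleGraph.connected_induce_compl_singleton (w ⟨0, hm⟩) (by simp) ?_
  have hw := reachableAvoiding_w_zero hm (x := v k) (by simp) (by simp)
  have hu : ∀ i, (staircase m).graph.ReachableAvoiding (v k) (u i) (w ⟨0, hm⟩) := fun i =>
    ((staircase_adj_wu i).symm.reachableAvoiding (by simp) (by simp)).trans (hw i)
  have hz : ∀ i, (staircase m).graph.ReachableAvoiding (v k) (z i) (w ⟨0, hm⟩) := by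
    intro i
    cases i using Fin.lastCases with
    | last =>
      have h := staircase_adj_next (m := m) ⟨m - 1, by omega⟩
      rw [next, dif_neg (by simp; omega)] at h
      exact (h.symm.reachableAvoiding (by simp) (by simp)).trans (hu _)
    | cast i => exact ((staircase_adj_wz i).symm.reachableAvoiding (by simp) (by simp)).trans (hw i)
  rintro (i | i | i | i) hi
  · exact ((staircase_adj_zv i).symm.reachableAvoiding hi (by simp)).trans (hz i)
  · exact hw i
  · exact hz i
  · exact hu i

theorem staircase_connected_delete_z (hm : 0 < m) (k : Fin (m + 1)) :
    ((staircase m).graph.induce {z k}ᶜ).Connected := by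
  refine SimpleGraph.connected_induce_compl_singleton (v 0) (by simp) ?_
  have hw' := reachableAvoiding_w_zero hm (x := z k) (by simp) (by simp)
  have hu' : ∀ i, (staircase m).graph.ReachableAvoiding (z k) (u i) (w ⟨0, hm⟩) := fun i =>
    ((staircase_adj_wu i).symm.reachableAvoiding (by simp) (by simp)).trans (hw' i)
  have hz : ∀ i, z i ≠ z k → (staircase m).graph.ReachableAvoiding (z k) (z i) (v 0) :=
    fun i => reachableAvoiding_z (by simp)
  have hhub : (staircase m).graph.ReachableAvoiding (z k) (w ⟨0, hm⟩) (v 0) := by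
    -- One surviving row joins the left boundary to the path of the v's: row 0, or row m if row 0 is
    -- the one cut.
    by_cases hk : z (Fin.castSucc ⟨0, hm⟩) = z k
    · have hl : z (Fin.last m) ≠ z k := by
        rw [← hk]
        simp [Fin.ext_iff]
        omega
      have h := staircase_adj_next (m := m) ⟨m - 1, by omega⟩
      rw [next, dif_neg (by simp; omega)] at h
      exact ((hu' _).symm.trans (h.reachableAvoiding (by simp) hl)).trans (hz _ hl)
    · exact ((staircase_adj_wz _).reachableAvoiding (by simp) hk).trans (hz _ hk)
  rintro (i | i | i | i) hi
  · exact reachableAvoiding_v (by simp) i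
  · exact (hw' i).trans hhub
  · exact hz i hi
  · exact (hu' i).trans hhub

theorem reachableAvoiding_w {x : StairVertex m} (hv : ∀ i, v i ≠ x) (hz : ∀ i, z i ≠ x)
    {i : Fin m} (hi : w i ≠ x) : (staircase m).graph.ReachableAvoiding x (w i) (v 0) :=
  ((staircase_adj_wz i).reachableAvoiding hi (hz _)).trans (reachableAvoiding_z hv (hz _))

theorem staircase_connected_delete_w (k : Fin m) :
    ((staircase m).graph.induce {w k}ᶜ).Connected := by
  refine SimpleGraph.connected_induce_compl_singleton (v 0) (by simp) ?_
  have hw : ∀ i, w i ≠ w k → (staircase m).graph.ReachableAvoiding (w k) (w i) (v 0) :=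
    fun i => reachableAvoiding_w (by simp) (by simp)
  rintro (i | i | i | i) hi
  · exact reachableAvoiding_v (by simp) i
  · exact hw i hi
  · exact reachableAvoiding_z (by simp) hi
  · by_cases h : w i = w k
    · obtain rfl : i = k := by simpa using h
      have h := staircase_adj_next i
      unfold next at h
      split_ifs at h with hi'
      · have hne : w ⟨i + 1, hi'⟩ ≠ w i := by simp [Fin.ext_iff]
        exact (h.reachableAvoiding hi hne).trans (hw _ hne)
      · exact (h.reachableAvoiding hi (by simp)).trans (reachableAvoiding_z (by simp) (by simp))
    · exact ((staircase_adj_wu i).symm.reachableAvoiding hi h).trans (hw i h)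

theorem staircase_connected_delete_u (k : Fin m) :
    ((staircase m).graph.induce {u k}ᶜ).Connected := by
  refine SimpleGraph.connected_induce_compl_singleton (v 0) (by simp) ?_
  have hw : ∀ i, (staircase m).graph.ReachableAvoiding (u k) (w i) (v 0) :=
    fun i => reachableAvoiding_w (by simp) (by simp) (by simp)
  rintro (i | i | i | i) hi
  · exact reachableAvoiding_v (by simp) i
  · exact hw i
  · exact reachableAvoiding_z (by simp) hi
  · exact ((staircase_adj_wu i).symm.reachableAvoiding hi (by simp)).trans (hw i)

theorem staircase_isBiconnected (hm : 1 ≤ m) : (staircase m).graph.IsBiconnected := by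
  refine ⟨?_, staircase_connected m, ?_⟩
  · rw [ENat.card_eq_coe_natCard, natCard]
    exact_mod_cast (by omega : 3 ≤ 4 * m + 2)
  · rintro (k | k | k | k)
    · exact staircase_connected_delete_v hm k
    · exact staircase_connected_delete_w k
    · exact staircase_connected_delete_z hm k
    · exact staircase_connected_delete_u k

end Connectivity

/-! ### Series-parallel decompositions of D_x and D_y. -/

section SeriesParallel

open StairVertex MultiDigraph

variable {m : ℕ}

/-- A label constant on each component and different on different components lets one work with
concrete nodes instead of the quotient. -/
theorem MultiDigraph.isSeriesParallel_of_label {V L E : Type} {G : SimpleGraph V}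
    (D : MultiDigraph G.ConnectedComponent E) (f : V → L) (src tgt : E → V)
    (hsrc : ∀ e, D.src e = G.connectedComponentMk (src e))
    (htgt : ∀ e, D.tgt e = G.connectedComponentMk (tgt e))
    (hadj : ∀ a b, G.Adj a b → f a = f b) (hf : ∀ a b, f a = f b → G.Reachable a b)
    (hnodes : ∀ a, ∃ e, f (src e) = f a ∨ f (tgt e) = f a) {s t : L}
    (h : (MultiDigraph.mk (f ∘ src) (f ∘ tgt)).SPPart Set.univ s t) :
    D.IsSeriesParallel := by
  constructor
  · refine Set.eq_univ_of_forall fun c => ?_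
    induction c using SimpleGraph.ConnectedComponent.ind with | _ a
    obtain ⟨e, he | he⟩ := hnodes a
    · exact .inl ⟨e, trivial, (hsrc e).trans (SimpleGraph.ConnectedComponent.sound (hf _ _ he))⟩
    · exact .inr ⟨e, trivial, (htgt e).trans (SimpleGraph.ConnectedComponent.sound (hf _ _ he))⟩
  · obtain ⟨g, hg, hgf⟩ := SimpleGraph.ConnectedComponent.exists_injective_label f hadj hf
    have : MultiDigraph.mk (f ∘ src) (f ∘ tgt) = D.mapNodes g := by
      simp [mapNodes, hsrc, htgt, hgf, Function.comp_def]
    rw [this] at h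
    obtain ⟨s, t, -, -, h⟩ := h.of_mapNodes hg
    exact ⟨s, t, h⟩

/-- A label of the maximal vertical path through a vertex. -/
def StairVertex.column : StairVertex m → ℕ × ℕ
  | v _ => (2, 0)
  | w i => (0, i)
  | u i => (0, i)
  | z i => if (i : ℕ) = m then (0, m) else (1, i)

/-- The position of a vertex within its family. -/
def StairVertex.index : StairVertex m → ℕ
  | v i => i
  | w i => i
  | u i => i
  | z i => i

/-- A label of the maximal horizontal path through a vertex. -/
def StairVertex.row : StairVertex m → ℕ
  | v i => i
  | w i => i
  | u i => i + 1
  | z i => i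

theorem column_next (i : Fin m) : (next i).column = (0, (i : ℕ) + 1) := by
  unfold next
  split_ifs with h
  · rfl
  · simp [column]
    omega

/-- The horizontal edges of the staircase. -/
abbrev HorizontalEdge (m : ℕ) : Type :=
  {e : StairVertex m × StairVertex m // StairRight m e.1 e.2}

/-- The vertical edges of the staircase. -/
abbrev VerticalEdge (m : ℕ) : Type :=
  {e : StairVertex m × StairVertex m // StairUp m e.1 e.2}

/-- The horizontal edges, as a multigraph on the column labels. -/
def columnDigraph (m : ℕ) :
    MultiDigraph (ℕ × ℕ) (HorizontalEdge m) where
  src e := e.1.1.column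
  tgt e := e.1.2.column

/-- The vertical edges, as a multigraph on the row labels. -/
def rowDigraph (m : ℕ) :
    MultiDigraph ℕ (VerticalEdge m) where
  src e := e.1.1.row
  tgt e := e.1.2.row

/-- Guarantees that the part already built does not touch the columns that the next induction step
adds. -/
theorem columnDigraph_nodes_subset (i : ℕ) :
    (columnDigraph m).nodes {e | i ≤ e.1.1.index} ⊆ {x | x.1 ≠ 2 → i ≤ x.2} := by
  rintro _ (⟨⟨⟨a, b⟩, h⟩, he, rfl⟩ | ⟨⟨⟨a, b⟩, h⟩, he, rfl⟩) <;>
    simp only [Set.mem_ofPred_eq, columnDigraph] at he ⊢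
  · cases h with
    | uw j k h => exact fun _ => he
    | uz j h => exact fun _ => he
    | wz j => exact fun _ => he
    | zv j =>
      simp only [index] at he
      simp only [column]
      split_ifs <;> simp <;> omega
  · cases h with
    | uw j k h => simp only [index, column] at he ⊢; omega
    | uz j h => simp only [index, column, Fin.val_last] at he ⊢; simp; omega
    | wz j =>
      simp only [index] at he
      simp only [column]
      split_ifs <;> simp <;> omega
    | zv j => simp [column]

/-- From the column of w_i and u_i there are two ways to the right side: the edge u_i → `next i`
followed by the part for i+1, or the path w_i, z_i, v_i. They are composed in parallel. Labelling
the column of z_m by (0, m) makes the single edge z_m → v_m the base case. -/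
theorem columnDigraph_spPart (i k : ℕ) (h : i + k = m) :
    (columnDigraph m).SPPart {e | i ≤ e.1.1.index} (0, i) (2, 0) := by
  induction k generalizing i with
  | zero =>
    obtain rfl : i = m := by omega
    have hset : {e : HorizontalEdge i |
        i ≤ e.1.1.index} = {⟨(z (Fin.last i), v (Fin.last i)), .zv _⟩} := by
      ext ⟨⟨a, b⟩, h⟩
      simp only [Set.mem_ofPred_eq, Set.mem_singleton_iff, Subtype.ext_iff, Prod.ext_iff]
      cases h <;> simp [index, Fin.ext_iff]
      all_goals omega
    rw [hset]
    exact .edge_of_eq (by simp [columnDigraph, column]) rfl (by simp)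
  | succ k ih =>
    obtain ⟨j, rfl⟩ : ∃ j : Fin m, (j : ℕ) = i := ⟨⟨i, by omega⟩, rfl⟩
    have ih' := ih (j + 1) (by omega)
    let e₀ : HorizontalEdge m := ⟨(u j, next j), stairRight_next j⟩
    let e₁ : HorizontalEdge m := ⟨(w j, z j.castSucc), .wz j⟩
    let e₂ : HorizontalEdge m := ⟨(z j.castSucc, v j.castSucc), .zv _⟩
    have hjm : (j : ℕ) ≠ m := by omega
    have hs0 : (columnDigraph m).src e₀ = (0, (j : ℕ)) := rfl
    have ht0 : (columnDigraph m).tgt e₀ = (0, (j : ℕ) + 1) := column_next j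
    have hs1 : (columnDigraph m).src e₁ = (0, (j : ℕ)) := rfl
    have ht1 : (columnDigraph m).tgt e₁ = (1, (j : ℕ)) := by
      simp [columnDigraph, e₁, column, hjm]
    have hs2 : (columnDigraph m).src e₂ = (1, (j : ℕ)) := by
      simp [columnDigraph, e₂, column, hjm]
    have ht2 : (columnDigraph m).tgt e₂ = (2, 0) := rfl
    have hset : {e : HorizontalEdge m | (j : ℕ) ≤ e.1.1.index} =
        ({e₀} ∪ {e : HorizontalEdge m | (j : ℕ) + 1 ≤ e.1.1.index}) ∪ ({e₁} ∪ {e₂}) := by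
      ext ⟨⟨a, b⟩, h⟩
      simp only [Set.mem_ofPred_eq, Set.mem_union, Set.mem_singleton_iff, e₀, e₁, e₂,
        Subtype.ext_iff, Prod.ext_iff]
      cases a with
      | u i =>
        obtain rfl := stairRight_u_iff.1 h
        simp only [index, u.injEq, Fin.ext_iff]
        constructor
        · intro h'
          rcases h'.lt_or_eq with h' | h'
          · exact .inl (.inr h')
          · exact .inl (.inl ⟨h'.symm, by rw [Fin.ext h']⟩)
        · rintro ((h' | h') | h' | h')
          · omega
          · omega
          · simp at h'
          · simp at h'
      | v i => cases h
      | w i => cases h; simp [index, Fin.ext_iff]; omega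
      | z i => cases h; simp [index, Fin.ext_iff]; omega
    have hsub := columnDigraph_nodes_subset (m := m) (j + 1)
    obtain ⟨hm1, hm2⟩ := ih'.endpoints_mem
    set A : Set (HorizontalEdge m) := {e : HorizontalEdge m | (j : ℕ) + 1 ≤ e.1.1.index} with hA
    rw [hset]
    have hn0 : (columnDigraph m).nodes {e₀} = {(0, (j : ℕ)), (0, (j : ℕ) + 1)} := by
      rw [nodes_singleton, hs0, ht0]
    have hn1 : (columnDigraph m).nodes {e₁} = {(0, (j : ℕ)), (1, (j : ℕ))} := by
      rw [nodes_singleton, hs1, ht1]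
    have hn2 : (columnDigraph m).nodes {e₂} = {(1, (j : ℕ)), (2, 0)} := by
      rw [nodes_singleton, hs2, ht2]
    have hj0 : ((0, (j : ℕ)) : ℕ × ℕ) ∉ (columnDigraph m).nodes A := fun h => by
      have := hsub h
      simp at this
    have hj1 : ((1, (j : ℕ)) : ℕ × ℕ) ∉ (columnDigraph m).nodes A := fun h => by
      have := hsub h
      simp at this
    have hupper : (columnDigraph m).SPPart ({e₀} ∪ A) (0, (j : ℕ)) (2, 0) := by
      refine .series (.edge_of_eq hs0 ht0 (by simp)) ih' ?_ ?_
      · simp [e₀, hA, index]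
      · rw [hn0]
        ext x
        simp only [Set.mem_inter_iff, Set.mem_insert_iff, Set.mem_singleton_iff]
        constructor
        · rintro ⟨rfl | rfl, h⟩
          · exact absurd h hj0
          · rfl
        · rintro rfl
          exact ⟨.inr rfl, hm1⟩
    have hlower : (columnDigraph m).SPPart ({e₁} ∪ {e₂}) (0, (j : ℕ)) (2, 0) := by
      refine .series (.edge_of_eq hs1 ht1 (by simp)) (.edge_of_eq hs2 ht2 (by simp)) ?_ ?_
      · simp [e₁, e₂, Subtype.ext_iff]
      · rw [hn1, hn2]
        ext x
        simp only [Set.mem_inter_iff, Set.mem_insert_iff, Set.mem_singleton_iff]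
        constructor
        · rintro ⟨rfl | rfl, h⟩
          · simp at h
          · rfl
        · rintro rfl
          simp
    refine .parallel hupper hlower ?_ ?_
    · simp [e₀, e₁, e₂, hA, index, Subtype.ext_iff]
    · rw [nodes_union, nodes_union, hn0, hn1, hn2]
      ext x
      simp only [Set.mem_inter_iff, Set.mem_union, Set.mem_insert_iff, Set.mem_singleton_iff]
      constructor
      · rintro ⟨h, (rfl | rfl) | (rfl | rfl)⟩
        · exact .inl rfl
        · rcases h with h | h
          · simp at h
          · exact absurd h hj1
        · rcases h with h | h
          · simp at h
          · exact absurd h hj1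
        · exact .inr rfl
      · rintro (rfl | rfl)
        · simp
        · exact ⟨.inr hm2, by simp⟩

/-- Rows j and j+1 are joined by exactly two vertical edges, so D_y is a series of parallel pairs.
-/
theorem rowDigraph_spPart (i : ℕ) (h : i < m) :
    (rowDigraph m).SPPart {e | e.1.1.row < i + 1} 0 (i + 1) := by
  let e₁ : Fin m → VerticalEdge m := fun j => ⟨(v j.castSucc, v j.succ), .vv j⟩
  let e₂ : Fin m → VerticalEdge m := fun j => ⟨(w j, u j), .wu j⟩
  have hset : ∀ j : Fin m, {e : VerticalEdge m | e.1.1.row < (j : ℕ) + 1} =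
      {e : VerticalEdge m | e.1.1.row < (j : ℕ)} ∪ ({e₁ j} ∪ {e₂ j}) := by
    intro j
    ext ⟨⟨a, b⟩, h⟩
    simp only [Set.mem_ofPred_eq, Set.mem_union, Set.mem_singleton_iff, e₁, e₂,
      Subtype.ext_iff, Prod.ext_iff]
    cases h <;> simp [row, Fin.ext_iff] <;> omega
  have hn : ∀ j : Fin m, (rowDigraph m).nodes {e₁ j} = {(j : ℕ), (j : ℕ) + 1} ∧
      (rowDigraph m).nodes {e₂ j} = {(j : ℕ), (j : ℕ) + 1} := by
    intro j
    rw [nodes_singleton, nodes_singleton]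
    exact ⟨rfl, rfl⟩
  have hpair : ∀ j : Fin m, (rowDigraph m).SPPart ({e₁ j} ∪ {e₂ j}) j (j + 1) := by
    intro j
    refine .parallel (.edge_of_eq rfl rfl (by simp)) (.edge_of_eq rfl rfl (by simp)) ?_ ?_
    · simp [e₁, e₂, Subtype.ext_iff]
    · rw [(hn j).1, (hn j).2, Set.inter_self]
  induction i with
  | zero =>
    have h0 := hset ⟨0, h⟩
    have h1 := hpair ⟨0, h⟩
    simp only [Nat.not_lt_zero, Set.ofPred_false, Set.empty_union] at h0
    rw [h0]
    exact h1
  | succ i ih =>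
    have h0 := hset ⟨i + 1, h⟩
    have h1 := hpair ⟨i + 1, h⟩
    have ih' := ih (by omega)
    simp only at h0 h1
    rw [h0]
    refine .series ih' h1 ?_ ?_
    · simp [e₁, e₂, row]
    · have hle : (rowDigraph m).nodes {e | e.1.1.row < i + 1} ⊆ {x | x ≤ i + 1} := by
        rintro _ (⟨⟨⟨a, b⟩, h⟩, he, rfl⟩ | ⟨⟨⟨a, b⟩, h⟩, he, rfl⟩) <;>
          simp only [Set.mem_ofPred_eq, rowDigraph] at he ⊢
        · exact he.le
        · cases h <;> simp [row] at he ⊢ <;> omega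
      rw [nodes_union, (hn _).1, (hn _).2, Set.union_self]
      ext x
      simp only [Set.mem_inter_iff, Set.mem_insert_iff, Set.mem_singleton_iff]
      constructor
      · rintro ⟨h, rfl | rfl⟩
        · rfl
        · have := hle h
          simp at this
      · rintro rfl
        exact ⟨ih'.endpoints_mem.2, .inl rfl⟩

theorem staircase_Dx_isSeriesParallel : (staircase m).Dx.IsSeriesParallel := by
  refine isSeriesParallel_of_label _ column (fun e => e.1.1) (fun e => e.1.2) (fun _ => rfl)
    (fun _ => rfl) ?_ ?_ ?_ (s := (0, 0)) (t := (2, 0)) ?_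
  · intro a b h
    rcases h.2 with h | h <;> cases h <;> rfl
  · have hv : ∀ i, (staircase m).verticalGraph.Reachable (v i) (v 0) := by
      intro i
      induction i using Fin.induction with
      | zero => rfl
      | succ i ih =>
        refine SimpleGraph.Reachable.trans (SimpleGraph.Adj.reachable ?_) ih
        exact ⟨by simpa using i.castSucc_lt_succ.ne', .inr (.vv i)⟩
    have hwu : ∀ i, (staircase m).verticalGraph.Reachable (w i) (u i) := fun i =>
      SimpleGraph.Adj.reachable ⟨by simp, .inl (.wu i)⟩
    have hz : ∀ (i : Fin (m + 1)) (a b : ℕ), (z i).column = (a, b) → b < m ∧ a ≠ 2 → a = 1 := by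
      intro i a b h h'
      simp only [column] at h
      split_ifs at h <;> simp at h <;> omega
    rintro (i | i | i | i) (j | j | j | j) h
    · exact (hv i).trans (hv j).symm
    · simp [column] at h
    · simp only [column] at h
      split_ifs at h
      all_goals simp at h
    · simp [column] at h
    · simp [column] at h
    · obtain rfl : i = j := by simpa [column, Fin.ext_iff] using h
      rfl
    · have := hz j _ _ h.symm ⟨i.2, by simp⟩
      simp at this
    · obtain rfl : i = j := by simpa [column, Fin.ext_iff] using h
      exact hwu i
    · simp only [column] at h
      split_ifs at h
      all_goals simp at h
    · have := hz i _ _ h ⟨j.2, by simp⟩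
      simp at this
    · obtain rfl : i = j := by
        simp only [column] at h
        split_ifs at h
        all_goals simp at h
        all_goals omega
      rfl
    · have := hz i _ _ h ⟨j.2, by simp⟩
      simp at this
    · simp [column] at h
    · obtain rfl : i = j := by simpa [column, Fin.ext_iff] using h
      exact (hwu i).symm
    · have := hz j _ _ h.symm ⟨i.2, by simp⟩
      simp at this
    · obtain rfl : i = j := by simpa [column, Fin.ext_iff] using h
      rfl
  · rintro (i | i | i | i)
    · exact ⟨⟨(z i, v i), .zv i⟩, .inr rfl⟩
    · exact ⟨⟨(w i, z i.castSucc), .wz i⟩, .inl rfl⟩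
    · exact ⟨⟨(z i, v i), .zv i⟩, .inl rfl⟩
    · exact ⟨⟨(u i, next i), stairRight_next i⟩, .inl rfl⟩
  · have h := columnDigraph_spPart (m := m) 0 m (by omega)
    simp only [Nat.zero_le, Set.ofPred_true] at h
    exact h

theorem staircase_Dy_isSeriesParallel (hm : 1 ≤ m) : (staircase m).Dy.IsSeriesParallel := by
  refine isSeriesParallel_of_label _ row (fun e => e.1.1) (fun e => e.1.2) (fun _ => rfl)
    (fun _ => rfl) ?_ ?_ ?_ (s := 0) (t := m - 1 + 1) ?_
  · have hr : ∀ a b : StairVertex m, StairRight m a b → a.row = b.row := by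
      intro a b h
      cases h <;> simp [row] <;> omega
    intro a b h
    rcases h.2 with h | h
    · exact hr _ _ h
    · exact (hr _ _ h).symm
  · have hadj : ∀ a b, StairRight m a b → (staircase m).horizontalGraph.Reachable a b := by
      intro a b h
      refine SimpleGraph.Adj.reachable ⟨?_, .inl h⟩
      rintro rfl
      cases h
    have hz : ∀ i, (staircase m).horizontalGraph.Reachable (z i) (v i) := fun i =>
      hadj _ _ (.zv i)
    have hw : ∀ i : Fin m, (staircase m).horizontalGraph.Reachable (w i) (v i.castSucc) :=
      fun i => (hadj _ _ (.wz i)).trans (hz _)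
    have hu : ∀ i : Fin m, (staircase m).horizontalGraph.Reachable (u i) (v i.succ) := by
      intro i
      refine (hadj _ _ (stairRight_next i)).trans ?_
      unfold next
      split_ifs with h
      · exact hw _
      · rw [show i.succ = Fin.last m from Fin.ext (by simp; omega)]
        exact hz _
    have hrep : ∀ a : StairVertex m, ∃ i : Fin (m + 1), (i : ℕ) = a.row ∧
        (staircase m).horizontalGraph.Reachable a (v i) := by
      rintro (i | i | i | i)
      · exact ⟨i, rfl, .refl _⟩
      · exact ⟨_, rfl, hw i⟩
      · exact ⟨_, rfl, hz i⟩
      · exact ⟨_, rfl, hu i⟩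
    intro a b h
    obtain ⟨i, hi, hai⟩ := hrep a
    obtain ⟨j, hj, hbj⟩ := hrep b
    obtain rfl : i = j := Fin.ext (by omega)
    exact hai.trans hbj.symm
  · have hv : ∀ k : ℕ, k < m + 1 → ∃ e : VerticalEdge m,
        e.1.1.row = k ∨ e.1.2.row = k := by
      intro k hk
      rcases k with _ | k
      · exact ⟨⟨(v (Fin.castSucc ⟨0, hm⟩), v (Fin.succ ⟨0, hm⟩)), .vv _⟩, .inl rfl⟩
      · exact ⟨⟨(v (Fin.castSucc ⟨k, by omega⟩), v (Fin.succ ⟨k, by omega⟩)), .vv _⟩, .inr rfl⟩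
    rintro (i | i | i | i)
    · exact hv _ i.2
    · exact hv _ (by simp [row])
    · exact hv _ i.2
    · exact hv _ (by simp [row])
  · have h := rowDigraph_spPart (m := m) (m - 1) (by omega)
    have hset : {e : VerticalEdge m |
        e.1.1.row < m - 1 + 1} = Set.univ := by
      refine Set.eq_univ_of_forall ?_
      rintro ⟨⟨a, b⟩, h⟩
      simp only [Set.mem_ofPred_eq]
      cases h <;> simp [row] <;> omega
    rw [hset] at h
    exact h

end SeriesParallel

/-! ### Exponential growth in every greedy drawing. -/

section GreedyBounds

open StairVertex

variable {m : ℕ} {p : StairVertex m → Plane}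

theorem staircase_v_fst (hp : (staircase m).IsDrawing p) (i : Fin (m + 1)) :
    p (v i) 0 = p (v 0) 0 := by
  induction i using Fin.induction with
  | zero => rfl
  | succ i ih => exact (hp.up_edge _ _ (.vv i)).1.symm.trans ih

theorem staircase_v_snd_strictMono (hp : (staircase m).IsDrawing p) :
    StrictMono fun i => p (v i) 1 :=
  Fin.strictMono_iff_lt_succ.2 fun i => (hp.up_edge _ _ (.vv i)).2

theorem staircase_z_snd (hp : (staircase m).IsDrawing p) (i : Fin (m + 1)) :
    p (z i) 1 = p (v i) 1 :=
  (hp.right_edge _ _ (.zv i)).1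

theorem staircase_w_snd (hp : (staircase m).IsDrawing p) (i : Fin m) :
    p (w i) 1 = p (v i.castSucc) 1 :=
  (hp.right_edge _ _ (.wz i)).1.trans (staircase_z_snd hp _)

theorem staircase_u_fst (hp : (staircase m).IsDrawing p) (i : Fin m) :
    p (u i) 0 = p (w i) 0 :=
  (hp.up_edge _ _ (.wu i)).1.symm

theorem staircase_u_snd (hp : (staircase m).IsDrawing p) (i : Fin m) :
    p (u i) 1 = p (v i.succ) 1 := by
  by_cases h : (i : ℕ) + 1 < m
  · exact (hp.right_edge _ _ (.uw i ⟨i + 1, h⟩ rfl)).1.trans (staircase_w_snd hp _)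
  · have hi : i.succ = Fin.last m := Fin.ext (by simp; omega)
    rw [(hp.right_edge _ _ (.uz i (by omega))).1, hi, staircase_z_snd hp]

theorem staircase_z_lt_v (hp : (staircase m).IsDrawing p) (i : Fin (m + 1)) :
    p (z i) 0 < p (v 0) 0 :=
  (hp.right_edge _ _ (.zv i)).2.trans_eq (staircase_v_fst hp i)

theorem staircase_w_lt_z_castSucc (hp : (staircase m).IsDrawing p) (i : Fin m) :
    p (w i) 0 < p (z i.castSucc) 0 :=
  (hp.right_edge _ _ (.wz i)).2

theorem staircase_w_lt_w (hp : (staircase m).IsDrawing p) {i j : Fin m}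
    (h : (j : ℕ) = i + 1) : p (w i) 0 < p (w j) 0 :=
  (staircase_u_fst hp i).symm.trans_lt (hp.right_edge _ _ (.uw i j h)).2

theorem staircase_w_lt_z_succ (hp : (staircase m).IsDrawing p) (i : Fin m) :
    p (w i) 0 < p (z i.succ) 0 := by
  by_cases h : (i : ℕ) + 1 < m
  · exact (staircase_w_lt_w hp (j := ⟨i + 1, h⟩) rfl).trans (staircase_w_lt_z_castSucc hp _)
  · have hi : i.succ = Fin.last m := Fin.ext (by simp; omega)
    rw [hi, ← staircase_u_fst hp]
    exact (hp.right_edge _ _ (.uz i (by omega))).2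

theorem staircase_adj_z {i : Fin (m + 1)} {c : StairVertex m}
    (h : (staircase m).graph.Adj (z i) c) :
    c = v i ∨ (∃ j : Fin m, j.castSucc = i ∧ c = w j) ∨
      ∃ j : Fin m, j.succ = i ∧ (j : ℕ) + 1 = m ∧ c = u j := by
  rcases (OrientedShape.graph_adj.1 h).2 with (h | h) | (h | h)
  · cases h
    exact .inl rfl
  · cases h
  · cases h with
    | wz j => exact .inr (.inl ⟨j, rfl, rfl⟩)
    | uz j hj => exact .inr (.inr ⟨j, Fin.ext (by simpa using hj), hj, rfl⟩)
  · cases h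

theorem staircase_adj_w {i : Fin m} {c : StairVertex m}
    (h : (staircase m).graph.Adj (w i) c) :
    c = z i.castSucc ∨ c = u i ∨ ∃ j : Fin m, (i : ℕ) = j + 1 ∧ c = u j := by
  rcases (OrientedShape.graph_adj.1 h).2 with (h | h) | (h | h)
  · cases h
    exact .inl rfl
  · cases h
    exact .inr (.inl rfl)
  · cases h with
    | uw j _ hj => exact .inr (.inr ⟨j, hj, rfl⟩)
  · cases h

/-- The first step of a distance-decreasing path from `z i`. -/
theorem greedy_step_z (hp : (staircase m).IsGreedyDrawing p) (i : Fin (m + 1))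
    {t : StairVertex m} (ht : z i ≠ t) :
    |p (v 0) 0 - p t 0| < |p (z i) 0 - p t 0| ∨
      ∃ j : Fin m, (j.castSucc = i ∨ j.succ = i ∧ (j : ℕ) + 1 = m) ∧
        |p (w j) 0 - p t 0| < |p (z i) 0 - p t 0| := by
  obtain ⟨c, hc, hd⟩ := hp.exists_adj_closer ht
  rcases staircase_adj_z hc with rfl | ⟨j, rfl, rfl⟩ | ⟨j, rfl, hj, rfl⟩
  · rw [Plane.dist_lt_iff_of_snd_eq _ (staircase_z_snd hp.1 i).symm, staircase_v_fst hp.1] at hd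
    exact .inl hd
  · rw [Plane.dist_lt_iff_of_snd_eq _
      (by rw [staircase_w_snd hp.1, staircase_z_snd hp.1])] at hd
    exact .inr ⟨j, .inl rfl, hd⟩
  -- In the last row the left neighbour is u_j, which has the abscissa of w_j.
  · rw [Plane.dist_lt_iff_of_snd_eq _
      (by rw [staircase_u_snd hp.1, staircase_z_snd hp.1]), staircase_u_fst hp.1] at hd
    exact .inr ⟨j, .inr ⟨rfl, hj⟩, hd⟩

/-- The first step of a distance-decreasing path from `w i` to a vertex that is not above it. -/
theorem greedy_step_w (hp : (staircase m).IsGreedyDrawing p) (i : Fin m)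
    {t : StairVertex m} (ht : w i ≠ t) (hle : p t 1 ≤ p (w i) 1) :
    |p (z i.castSucc) 0 - p t 0| < |p (w i) 0 - p t 0| ∨
      ∃ j : Fin m, (i : ℕ) = j + 1 ∧ |p (w j) 0 - p t 0| < |p (w i) 0 - p t 0| := by
  obtain ⟨c, hc, hd⟩ := hp.exists_adj_closer ht
  rcases staircase_adj_w hc with rfl | rfl | ⟨j, hj, rfl⟩
  · rw [Plane.dist_lt_iff_of_snd_eq _
      (by rw [staircase_w_snd hp.1, staircase_z_snd hp.1])] at hd
    exact .inl hd
  -- Moving up leads away from a target that is not above.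
  · have hup := hp.1.up_edge _ _ (.wu i)
    rw [Plane.dist_lt_iff_of_fst_eq _ hup.1.symm, abs_of_nonneg (by linarith),
      abs_of_nonneg (by linarith)] at hd
    linarith
  · have hji : j.succ = i.castSucc := Fin.ext (by simp [hj])
    rw [Plane.dist_lt_iff_of_snd_eq _
      (by rw [staircase_w_snd hp.1, staircase_u_snd hp.1, hji]), staircase_u_fst hp.1] at hd
    exact .inr ⟨j, hj, hd⟩

/-- Both z's have left neighbours at the abscissa of w_i. The z further to the left cannot approach
the other by moving left, so it must move right to the v's; that step closes in only if the other z
lies beyond the midpoint, which is the factor two. -/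
theorem greedy_last_rows (hp : (staircase m).IsGreedyDrawing p) (i : Fin m)
    (hi : (i : ℕ) + 1 = m) :
    2 * (p (v 0) 0 - p (z i.succ) 0) < p (v 0) 0 - p (z i.castSucc) 0 ∨
      2 * (p (v 0) 0 - p (z i.castSucc) 0) < p (v 0) 0 - p (z i.succ) 0 := by
  have hX := staircase_z_lt_v hp.1 i.castSucc
  have hX' := staircase_z_lt_v hp.1 i.succ
  have hb := staircase_w_lt_z_castSucc hp.1 i
  have hb' := staircase_w_lt_z_succ hp.1 i
  have hne : i.castSucc ≠ i.succ := i.castSucc_lt_succ.ne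
  rcases greedy_step_z hp i.castSucc (t := z i.succ) (by simpa using hne) with
    h | ⟨j, hj | ⟨hj, hj'⟩, h⟩
  · rw [abs_of_pos (by linarith), lt_abs] at h
    rcases h with h | h
    · linarith
    · left; linarith
  · obtain rfl : j = i := by simpa using hj
    rw [abs_of_neg (a := p (w j) 0 - _) (by linarith), lt_abs] at h
    have h1 : p (z j.succ) 0 < p (z j.castSucc) 0 := by rcases h with h | h <;> linarith
    rcases greedy_step_z hp j.succ (t := z j.castSucc) (by simpa using hne.symm) with
      h | ⟨k, hk | ⟨hk, hk'⟩, h⟩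
    · rw [abs_of_pos (by linarith), abs_of_neg (by linarith)] at h
      right; linarith
    · have := k.2
      rw [Fin.ext_iff] at hk
      simp at hk
      omega
    · obtain rfl : k = j := by simpa using hk
      rw [abs_of_neg (by linarith), abs_of_neg (by linarith)] at h
      linarith
  · rw [Fin.ext_iff] at hj
    simp at hj
    omega

/-- The factor two in `hj` is allowed in either direction because the last two rows may be ordered
either way; this is the induction hypothesis for the row below. -/
theorem greedy_inner_rows (hp : (staircase m).IsGreedyDrawing p) {i j : Fin m}
    (hij : (j : ℕ) = i + 1)
    (hj : 2 * (p (v 0) 0 - p (z j.succ) 0) < p (v 0) 0 - p (z j.castSucc) 0 ∨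
      2 * (p (v 0) 0 - p (z j.castSucc) 0) < p (v 0) 0 - p (z j.succ) 0) :
    2 * (p (v 0) 0 - p (w j) 0) < p (v 0) 0 - p (z i.castSucc) 0 := by
  have hX0 := staircase_z_lt_v hp.1 i.castSucc
  have hX1 := staircase_z_lt_v hp.1 j.castSucc
  have hX2 := staircase_z_lt_v hp.1 j.succ
  have hb0 := staircase_w_lt_z_castSucc hp.1 i
  have hb01 := staircase_w_lt_w hp.1 hij
  have hb1 := staircase_w_lt_z_castSucc hp.1 j
  have hb2 := staircase_w_lt_z_succ hp.1 j
  have hjm := j.2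
  have hleft : ∀ k : Fin m, (k.castSucc = i.castSucc ∨ k.succ = i.castSucc ∧ (k : ℕ) + 1 = m) →
      k = i := by
    intro k hk
    simp only [Fin.ext_iff, Fin.val_castSucc, Fin.val_succ] at hk ⊢
    omega
  have hleft' : ∀ k : Fin m, (k.castSucc = j.castSucc ∨ k.succ = j.castSucc ∧ (k : ℕ) + 1 = m) →
      k = j := by
    intro k hk
    simp only [Fin.ext_iff, Fin.val_castSucc, Fin.val_succ] at hk ⊢
    omega
  by_contra hcon
  -- Stepping right from z_i towards w_j would give the claim, so `hcon` forces a left step, which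
  -- helps only if w_j lies left of z_i.
  have hlow : p (w j) 0 < p (z i.castSucc) 0 := by
    rcases greedy_step_z hp i.castSucc (t := w j) (by simp) with h | ⟨k, hk, h⟩
    · rw [abs_of_pos (by linarith), lt_abs] at h
      rcases h with h | h
      · linarith
      · exact absurd (by linarith) hcon
    · obtain rfl := hleft k hk
      rw [abs_of_neg (a := p (w k) 0 - _) (by linarith), lt_abs] at h
      rcases h with h | h <;> linarith
  have hsnd : p (z i.castSucc) 1 ≤ p (w j) 1 := by
    rw [staircase_z_snd hp.1, staircase_w_snd hp.1]
    exact (staircase_v_snd_strictMono hp.1).monotone (Fin.le_def.2 (by simp; omega))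
  -- From w_j towards z_i neither the step up nor the step left can help, so z_j must be closer.
  have h1 : |p (z j.castSucc) 0 - p (z i.castSucc) 0| < p (z i.castSucc) 0 - p (w j) 0 := by
    rcases greedy_step_w hp j (t := z i.castSucc) (by simp) hsnd with h | ⟨k, hk, h⟩
    · rwa [abs_of_neg (a := p (w j) 0 - _) (by linarith), neg_sub] at h
    · obtain rfl : k = i := Fin.ext (by omega)
      rw [abs_of_neg (by linarith), abs_of_neg (by linarith)] at h
      linarith
  have hne : j.castSucc ≠ i.castSucc := by simp [Fin.ext_iff]; omega
  -- By `h1`, z_j cannot go back to w_j. It must step right, which amounts to 2 d(z_i) < d(z_j).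
  have hD1 : p (v 0) 0 - p (z i.castSucc) 0 < p (z i.castSucc) 0 - p (z j.castSucc) 0 := by
    rcases greedy_step_z hp j.castSucc (t := z i.castSucc) (by simpa using hne) with
      h | ⟨k, hk, h⟩
    · rw [abs_of_pos (by linarith), lt_abs] at h
      rcases h with h | h <;> linarith
    · obtain rfl := hleft' k hk
      rw [abs_of_neg (a := p (w k) 0 - _) (by linarith)] at h
      linarith
  rcases hj with hj | hj
  · have hne2 : j.succ ≠ i.castSucc := by simp [Fin.ext_iff]; omega
    -- A left step would give d(z_i) + d(w_i) < 2 d(z_{j+1}) < d(z_j) < d(w_j) < d(w_i), so the step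
    -- is to the right and z_{j+1} lies right of z_i.
    have hD2 : p (v 0) 0 - p (z j.succ) 0 < p (z j.succ) 0 - p (z i.castSucc) 0 := by
      rcases greedy_step_z hp i.castSucc (t := z j.succ) (by simpa using hne2.symm) with
        h | ⟨k, hk, h⟩
      · rw [abs_of_pos (by linarith), lt_abs] at h
        rcases h with h | h <;> linarith
      · obtain rfl := hleft k hk
        rw [abs_of_neg (a := p (w k) 0 - _) (by linarith), lt_abs] at h
        rcases h with h | h <;> linarith
    -- Now z_{j+1} is stuck on the way to z_i. Right is further away; to the left, w_{j+1} would
    -- have to lead back or on to the abscissa of w_j, too far since 2 d(z_i) < d(w_j). In the last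
    -- row the left neighbour is already at that abscissa.
    rcases greedy_step_z hp j.succ (t := z i.castSucc) (by simpa using hne2) with
      h | ⟨k, hk | hk, h⟩
    · rw [abs_of_pos (by linarith), abs_of_pos (by linarith)] at h
      linarith
    · have hkj : (k : ℕ) = j + 1 := by simpa [Fin.ext_iff] using hk
      have hkX := staircase_w_lt_z_castSucc hp.1 k
      rw [hk] at hkX
      have hksnd : p (z i.castSucc) 1 ≤ p (w k) 1 := by
        rw [staircase_z_snd hp.1, staircase_w_snd hp.1]
        exact (staircase_v_snd_strictMono hp.1).monotone (Fin.le_def.2 (by simp; omega))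
      rcases greedy_step_w hp k (t := z i.castSucc) (by simp) hksnd with h' | ⟨l, hl, h'⟩
      · rw [hk] at h'
        linarith
      · obtain rfl : l = j := Fin.ext (by omega)
        have hbk := staircase_w_lt_w hp.1 hl
        rw [abs_of_neg (a := p (w l) 0 - _) (by linarith), lt_abs] at h'
        rcases h' with h' | h' <;> linarith
    · obtain rfl : k = j := by simpa using hk.1
      rw [abs_of_neg (by linarith), abs_of_pos (by linarith)] at h
      linarith
  -- Here z_i is stuck on the way to z_j: right is further away, and left would give d(w_i) + d(z_i)
  -- < 2 d(z_j) < d(z_{j+1}) < d(w_j) < d(w_i).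
  · rcases greedy_step_z hp i.castSucc (t := z j.castSucc) (by simpa using hne.symm) with
      h | ⟨k, hk, h⟩
    · rw [abs_of_pos (by linarith), abs_of_pos (by linarith)] at h
      linarith
    · obtain rfl := hleft k hk
      rw [abs_of_neg (by linarith), abs_of_pos (by linarith)] at h
      linarith

/-- Induction from the last row downwards. Below it the first alternative always holds, because w_j
lies left of z_j. -/
theorem greedy_rows (hp : (staircase m).IsGreedyDrawing p) (k : ℕ) :
    ∀ i : Fin m, (i : ℕ) + 1 + k = m →
      2 * (p (v 0) 0 - p (z i.succ) 0) < p (v 0) 0 - p (z i.castSucc) 0 ∨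
        2 * (p (v 0) 0 - p (z i.castSucc) 0) < p (v 0) 0 - p (z i.succ) 0 := by
  induction k with
  | zero => exact fun i hi => greedy_last_rows hp i hi
  | succ k ih =>
    intro i hi
    let j : Fin m := ⟨i + 1, by omega⟩
    have hji : j.castSucc = i.succ := rfl
    have h := greedy_inner_rows hp (i := i) (j := j) rfl (ih j (by simp [j]; omega))
    have hb := staircase_w_lt_z_castSucc hp.1 j
    rw [hji] at hb
    left; linarith

theorem greedy_two_mul_w_lt_z (hp : (staircase m).IsGreedyDrawing p) {i j : Fin m}
    (hij : (j : ℕ) = i + 1) :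
    2 * (p (v 0) 0 - p (w j) 0) < p (v 0) 0 - p (z i.castSucc) 0 :=
  greedy_inner_rows hp hij (greedy_rows hp (m - (j + 1)) j (by omega))

/-- In the last two rows both z's have d at least 1 and one has d more than 2, and w_{m-1} lies left
of both. Each row further down doubles: d(w_i) > d(z_i) > 2 d(w_{i+1}). -/
theorem greedy_two_pow_le_w (hp : (staircase m).IsGreedyDrawing p)
    (h1 : ∀ a b : StairVertex m, a ≠ b → 1 ≤ dist (p a) (p b)) (k : ℕ) :
    ∀ i : Fin m, (i : ℕ) + 1 + k = m → (2 : ℝ) ^ (k + 1) ≤ p (v 0) 0 - p (w i) 0 := by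
  have hz : ∀ i : Fin (m + 1), 1 ≤ p (v 0) 0 - p (z i) 0 := by
    intro i
    have h := h1 (v i) (z i) (by simp)
    have hX := staircase_z_lt_v hp.1 i
    rwa [Plane.dist_of_snd_eq (staircase_z_snd hp.1 i).symm, staircase_v_fst hp.1,
      abs_of_pos (by linarith)] at h
  induction k with
  | zero =>
    intro i hi
    have hb := staircase_w_lt_z_castSucc hp.1 i
    have hb' := staircase_w_lt_z_succ hp.1 i
    have hz0 := hz i.castSucc
    have hz1 := hz i.succ
    rcases greedy_last_rows hp i hi with h | h <;> norm_num <;> linarith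
  | succ k ih =>
    intro i hi
    have h := ih ⟨i + 1, by omega⟩ (by simp; omega)
    have h' := greedy_two_mul_w_lt_z hp (i := i) (j := ⟨i + 1, by omega⟩) rfl
    have hb := staircase_w_lt_z_castSucc hp.1 i
    rw [pow_succ]
    linarith

theorem sub_le_iSup_sub_iInf {V : Type} [Finite V] (f : V → ℝ) (a b : V) :
    f a - f b ≤ (⨆ x, f x) - ⨅ x, f x :=
  sub_le_sub (le_ciSup (Set.finite_range f).bddAbove a) (ciInf_le (Set.finite_range f).bddBelow b)

theorem greedy_two_pow_le_drawingArea (hm : 1 ≤ m) (hp : (staircase m).IsGreedyDrawing p)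
    (h1 : ∀ a b : StairVertex m, a ≠ b → 1 ≤ dist (p a) (p b)) :
    (2 : ℝ) ^ m ≤ drawingArea p := by
  have hw := greedy_two_pow_le_w hp h1 (m - 1) ⟨0, hm⟩ (by simp; omega)
  rw [Nat.sub_add_cancel hm] at hw
  have hh : 1 ≤ p (v (Fin.succ ⟨0, hm⟩)) 1 - p (v (Fin.castSucc ⟨0, hm⟩)) 1 := by
    have hup := hp.1.up_edge _ _ (.vv ⟨0, hm⟩)
    have h := h1 (v (Fin.succ ⟨0, hm⟩)) (v (Fin.castSucc ⟨0, hm⟩)) (by simp)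
    rwa [Plane.dist_of_fst_eq hup.1.symm, abs_of_pos (by linarith [hup.2])] at h
  have hW := sub_le_iSup_sub_iInf (fun a => p a 0) (v 0) (w ⟨0, hm⟩)
  have hH := sub_le_iSup_sub_iInf (fun a => p a 1) (v (Fin.succ ⟨0, hm⟩))
    (v (Fin.castSucc ⟨0, hm⟩))
  unfold drawingArea
  nlinarith [pow_pos (two_pos (α := ℝ)) m]

end GreedyBounds

/-! ### A greedy drawing on the integer grid. -/

section GreedyDrawing

open StairVertex

variable {m : ℕ}

/-- The distance of `z i` from the right side in the drawing `stairDrawing`. -/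
def stairGap (m i : ℕ) : ℝ := 4 * 3 ^ (m - i)

theorem four_le_stairGap (m i : ℕ) : 4 ≤ stairGap m i := by
  unfold stairGap
  linarith [one_le_pow₀ (n := m - i) (by norm_num : (1 : ℝ) ≤ 3)]

/-- The ratio 3 instead of 2 absorbs the unit offset of w and u: a gap K ≥ 4 satisfies 2(K + 1) <
3K, so targets of larger index stay in the right half of the earlier gap. -/
theorem stairGap_lt {i j : ℕ} (hij : i < j) (hj : j ≤ m) : 3 * stairGap m j ≤ stairGap m i := by
  unfold stairGap
  have : (3 : ℝ) ^ (m - j + 1) ≤ 3 ^ (m - i) :=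
    pow_le_pow_right₀ (by norm_num) (by omega)
  rw [pow_succ] at this
  linarith

theorem stairGap_succ {i : ℕ} (hi : i + 1 ≤ m) : stairGap m i = 3 * stairGap m (i + 1) := by
  unfold stairGap
  rw [show m - i = m - (i + 1) + 1 by omega, pow_succ]
  ring

theorem stairGap_le {i j : ℕ} (hij : i ≤ j) (hj : j ≤ m) : stairGap m j ≤ stairGap m i := by
  rcases hij.eq_or_lt with rfl | h
  · rfl
  · linarith [stairGap_lt h hj, four_le_stairGap m j]

/-- A greedy drawing of the staircase on the integer grid. -/
def stairDrawing (m : ℕ) : StairVertex m → Plane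
  | v i => !₂[0, (i : ℝ)]
  | w i => !₂[-(stairGap m i + 1), (i : ℝ)]
  | z i => !₂[-stairGap m i, (i : ℝ)]
  | u i => !₂[-(stairGap m i + 1), (i : ℝ) + 1]

theorem stairDrawing_v_fst (i : Fin (m + 1)) : stairDrawing m (v i) 0 = 0 := rfl

theorem stairDrawing_w_fst (i : Fin m) : stairDrawing m (w i) 0 = -(stairGap m i + 1) := rfl

theorem stairDrawing_z_fst (i : Fin (m + 1)) : stairDrawing m (z i) 0 = -stairGap m i := rfl

theorem stairDrawing_u_fst (i : Fin m) : stairDrawing m (u i) 0 = -(stairGap m i + 1) := rfl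

theorem stairDrawing_snd (a : StairVertex m) : stairDrawing m a 1 = a.row := by
  cases a
  · rfl
  · rfl
  · rfl
  · simp [stairDrawing, row]

theorem stairDrawing_onIntegerGrid (m : ℕ) : OnIntegerGrid (stairDrawing m) := by
  intro a
  have hgap : ∀ i : ℕ, stairGap m i = ((4 * 3 ^ (m - i) : ℤ) : ℝ) := fun i => by
    simp [stairGap]
  have hx : ∃ x : ℤ, stairDrawing m a 0 = x := by
    cases a with
    | v i => exact ⟨0, by simp [stairDrawing_v_fst]⟩
    | w i => exact ⟨-(4 * 3 ^ (m - i) + 1), by rw [stairDrawing_w_fst, hgap]; push_cast; rfl⟩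
    | z i => exact ⟨-(4 * 3 ^ (m - i)), by rw [stairDrawing_z_fst, hgap]; push_cast; rfl⟩
    | u i => exact ⟨-(4 * 3 ^ (m - i) + 1), by rw [stairDrawing_u_fst, hgap]; push_cast; rfl⟩
  obtain ⟨x, hx⟩ := hx
  exact ⟨x, a.row, hx, by rw [stairDrawing_snd]; simp⟩

/-- With K the gap of the row, the possible abscissae are -(3K + 1) for u, -(K + 1) for w, -K for z
and 0 for v. -/
theorem stairDrawing_eq_of_row {a b : StairVertex m} (hrow : a.row = b.row)
    (hx : stairDrawing m a 0 = stairDrawing m b 0) : a = b := by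
  rcases a with i | i | i | i <;> rcases b with j | j | j | j <;>
    simp only [row, stairDrawing_v_fst, stairDrawing_w_fst, stairDrawing_z_fst,
      stairDrawing_u_fst] at hrow hx <;>
    have hi := four_le_stairGap m i <;> have hj := four_le_stairGap m j
  · rw [Fin.ext hrow]
  · linarith
  · linarith
  · linarith
  · linarith
  · rw [Fin.ext hrow]
  · rw [hrow] at hx; linarith
  · have h := stairGap_succ (m := m) (i := j) (by omega)
    rw [hrow] at hx hi
    linarith
  · linarith
  · rw [hrow] at hx; linarith
  · rw [Fin.ext hrow]
  · have h := stairGap_succ (m := m) (i := j) (by omega)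
    rw [hrow] at hx hi
    linarith
  · linarith
  · have h := stairGap_succ (m := m) (i := i) (by omega)
    rw [← hrow] at hx hj
    linarith
  · have h := stairGap_succ (m := m) (i := i) (by omega)
    rw [← hrow] at hx hj
    linarith
  · rw [Fin.ext (by omega : (i : ℕ) = j)]

theorem stairRight_row {a b : StairVertex m} (h : StairRight m a b) : a.row = b.row := by
  cases h <;> simp [row] <;> omega

theorem stairRight_fst_lt {a b : StairVertex m} (h : StairRight m a b) :
    stairDrawing m a 0 < stairDrawing m b 0 := by
  cases h with
  | uw i j h =>
    rw [stairDrawing_u_fst, stairDrawing_w_fst]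
    linarith [stairGap_lt (m := m) (i := i) (j := j) (by omega) (by omega), four_le_stairGap m j]
  | uz i h =>
    rw [stairDrawing_u_fst, stairDrawing_z_fst]
    linarith [stairGap_lt (m := m) (i := i) (j := Fin.last m) (by simp) (by simp),
      four_le_stairGap m (Fin.last m)]
  | wz i =>
    rw [stairDrawing_w_fst, stairDrawing_z_fst, Fin.val_castSucc]
    linarith
  | zv i =>
    rw [stairDrawing_v_fst, stairDrawing_z_fst]
    linarith [four_le_stairGap m i]

/-- Consecutive vertices of a row are neighbours. -/
theorem stairRight_between {a b c : StairVertex m} (h : StairRight m a b) (hrow : c.row = a.row)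
    (hac : stairDrawing m a 0 ≤ stairDrawing m c 0)
    (hcb : stairDrawing m c 0 ≤ stairDrawing m b 0) : c = a ∨ c = b := by
  cases c with
  | v k =>
    have hb : b = v k := by
      cases h with
      | zv i => rw [Fin.ext hrow]
      | uw i j h =>
        rw [stairDrawing_v_fst, stairDrawing_w_fst] at hcb
        linarith [four_le_stairGap m j]
      | uz i h =>
        rw [stairDrawing_v_fst, stairDrawing_z_fst] at hcb
        linarith [four_le_stairGap m (Fin.last m)]
      | wz i =>
        rw [stairDrawing_v_fst, stairDrawing_z_fst] at hcb
        linarith [four_le_stairGap m i.castSucc]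
    exact .inr hb.symm
  | w k =>
    cases h with
    | zv i =>
      rw [stairDrawing_w_fst, stairDrawing_z_fst] at hac
      simp only [row] at hrow
      rw [hrow] at hac
      linarith
    | uw i j h =>
      simp only [row] at hrow
      exact .inr (by rw [Fin.ext (by omega : (k : ℕ) = j)])
    | uz i h =>
      simp only [row] at hrow
      omega
    | wz i => exact .inl (by rw [Fin.ext hrow])
  | z k =>
    cases h with
    | zv i => exact .inl (by rw [Fin.ext hrow])
    | uw i j h =>
      rw [stairDrawing_w_fst, stairDrawing_z_fst] at hcb
      simp only [row] at hrow
      rw [show (k : ℕ) = j by omega] at hcb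
      linarith
    | uz i h =>
      simp only [row] at hrow
      exact .inr (by rw [Fin.ext (by simp; omega : (k : ℕ) = Fin.last m)])
    | wz i => exact .inr (by rw [Fin.ext (by simpa [row] using hrow : (k : ℕ) = i.castSucc)])
  | u k =>
    cases h with
    | zv i =>
      rw [stairDrawing_u_fst, stairDrawing_z_fst] at hac
      have := stairGap_le (m := m) (i := k) (j := i) (by simp only [row] at hrow; omega) (by omega)
      linarith
    | uw i j h => exact .inl (by rw [Fin.ext (by simpa [row] using hrow : (k : ℕ) = i)])
    | uz i h => exact .inl (by rw [Fin.ext (by simpa [row] using hrow : (k : ℕ) = i)])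
    | wz i =>
      rw [stairDrawing_u_fst, stairDrawing_w_fst] at hac
      have := stairGap_lt (m := m) (i := k) (j := i) (by simp only [row] at hrow; omega) (by omega)
      linarith [four_le_stairGap m i]

theorem stairUp_row {a b : StairVertex m} (h : StairUp m a b) : b.row = a.row + 1 := by
  cases h <;> simp [row]

theorem stairUp_fst {a b : StairVertex m} (h : StairUp m a b) :
    stairDrawing m a 0 = stairDrawing m b 0 := by
  cases h <;> rfl

theorem stairDrawing_isDrawing (m : ℕ) : (staircase m).IsDrawing (stairDrawing m) := by
  have hr : ∀ a b, StairRight m a b →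
      stairDrawing m a 1 = stairDrawing m b 1 ∧ stairDrawing m a 0 < stairDrawing m b 0 :=
    fun a b h => ⟨by rw [stairDrawing_snd, stairDrawing_snd, stairRight_row h],
      stairRight_fst_lt h⟩
  have hu : ∀ a b, StairUp m a b →
      stairDrawing m a 0 = stairDrawing m b 0 ∧ stairDrawing m a 1 < stairDrawing m b 1 :=
    fun a b h => ⟨stairUp_fst h, by
      rw [stairDrawing_snd, stairDrawing_snd, stairUp_row h]; push_cast; linarith⟩
  have hmem : ∀ a b c, StairUp m a b →
      ∀ P ∈ segment ℝ (stairDrawing m a) (stairDrawing m b), P 1 = stairDrawing m c 1 →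
      P = stairDrawing m a ∨ P = stairDrawing m b := by
    intro a b c h P hP hc
    rw [Plane.mem_segment_of_fst_eq (hu a b h).1 (hu a b h).2] at hP
    obtain ⟨h0, h1, h2⟩ := hP
    rw [hc, stairDrawing_snd, stairDrawing_snd, Nat.cast_le] at h1 h2
    have hrow := stairUp_row h
    have : c.row = a.row ∨ c.row = b.row := by omega
    rcases this with hc' | hc'
    · exact .inl (Plane.ext_coords h0 (by rw [hc, stairDrawing_snd, stairDrawing_snd, hc']))
    · exact .inr (Plane.ext_coords (h0.trans (hu a b h).1)
        (by rw [hc, stairDrawing_snd, stairDrawing_snd, hc']))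
  have hinj : Function.Injective (stairDrawing m) := by
    intro a b h
    have h1 : stairDrawing m a 1 = stairDrawing m b 1 := by rw [h]
    rw [stairDrawing_snd, stairDrawing_snd, Nat.cast_inj] at h1
    exact stairDrawing_eq_of_row h1 (by rw [h])
  refine OrientedShape.isDrawing_of_forall hinj hr hu ?_ ?_
  · rintro a b c (h | h) hc
    · rw [Plane.mem_segment_of_snd_eq (hr a b h).1 (hr a b h).2, stairDrawing_snd,
        stairDrawing_snd, Nat.cast_inj] at hc
      exact stairRight_between h hc.1 hc.2.1 hc.2.2
    · exact (hmem a b c h _ hc rfl).imp (@hinj _ _) (@hinj _ _)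
  · rintro a b c d h h' P ⟨hP, hP'⟩
    rw [Plane.mem_segment_of_snd_eq (hr a b h).1 (hr a b h).2] at hP
    rcases hmem c d a h' P hP' hP.1 with h | h
    · exact ⟨c, h⟩
    · exact ⟨d, h⟩

/-- A horizontal step gains exactly when the target lies beyond the midpoint of the edge. -/
theorem closer_of_lt_fst {A B T : Plane} (h1 : A 1 = B 1) (h : A 0 < B 0)
    (h' : A 0 + B 0 < 2 * T 0) : dist B T < dist A T := by
  rw [Plane.dist_lt_iff_of_snd_eq _ h1.symm, ← sq_lt_sq]
  nlinarith

theorem closer_of_fst_lt {A B T : Plane} (h1 : A 1 = B 1) (h : B 0 < A 0)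
    (h' : 2 * T 0 < A 0 + B 0) : dist B T < dist A T := by
  rw [Plane.dist_lt_iff_of_snd_eq _ h1.symm, ← sq_lt_sq]
  nlinarith

theorem closer_of_lt_snd {A B T : Plane} (h0 : A 0 = B 0) (h : A 1 < B 1)
    (h' : B 1 ≤ T 1) : dist B T < dist A T := by
  rw [Plane.dist_lt_iff_of_fst_eq _ h0.symm, ← sq_lt_sq]
  nlinarith

theorem closer_of_snd_lt {A B T : Plane} (h0 : A 0 = B 0) (h : B 1 < A 1)
    (h' : T 1 ≤ B 1) : dist B T < dist A T := by
  rw [Plane.dist_lt_iff_of_fst_eq _ h0.symm, ← sq_lt_sq]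
  nlinarith

theorem stairDrawing_closer_right {a b t : StairVertex m} (h : StairRight m a b)
    (ht : stairDrawing m a 0 + stairDrawing m b 0 < 2 * stairDrawing m t 0) :
    ∃ c, (staircase m).graph.Adj a c ∧
      dist (stairDrawing m c) (stairDrawing m t) < dist (stairDrawing m a) (stairDrawing m t) :=
  ⟨b, staircase_adj_of_right h, closer_of_lt_fst
    ((stairDrawing_isDrawing m).right_edge _ _ h).1 (stairRight_fst_lt h) ht⟩

theorem stairDrawing_closer_left {a b t : StairVertex m} (h : StairRight m b a)
    (ht : 2 * stairDrawing m t 0 < stairDrawing m a 0 + stairDrawing m b 0) :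
    ∃ c, (staircase m).graph.Adj a c ∧
      dist (stairDrawing m c) (stairDrawing m t) < dist (stairDrawing m a) (stairDrawing m t) :=
  ⟨b, (staircase_adj_of_right h).symm, closer_of_fst_lt
    ((stairDrawing_isDrawing m).right_edge _ _ h).1.symm (stairRight_fst_lt h) ht⟩

theorem stairDrawing_closer_up {a b t : StairVertex m} (h : StairUp m a b)
    (ht : a.row < t.row) :
    ∃ c, (staircase m).graph.Adj a c ∧
      dist (stairDrawing m c) (stairDrawing m t) < dist (stairDrawing m a) (stairDrawing m t) :=
  ⟨b, staircase_adj_of_up h, closer_of_lt_snd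
    (stairUp_fst h) ((stairDrawing_isDrawing m).up_edge _ _ h).2 (by
      rw [stairDrawing_snd, stairDrawing_snd, stairUp_row h]; exact Nat.cast_le.2 ht)⟩

theorem stairDrawing_closer_down {a b t : StairVertex m} (h : StairUp m b a)
    (ht : t.row < a.row) :
    ∃ c, (staircase m).graph.Adj a c ∧
      dist (stairDrawing m c) (stairDrawing m t) < dist (stairDrawing m a) (stairDrawing m t) :=
  ⟨b, (staircase_adj_of_up h).symm, closer_of_snd_lt
    (stairUp_fst h).symm ((stairDrawing_isDrawing m).up_edge _ _ h).2 (by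
      rw [stairDrawing_snd, stairDrawing_snd]
      rw [stairUp_row h] at ht
      exact Nat.cast_le.2 (Nat.lt_succ_iff.1 ht))⟩

/-- The horizontal position of a vertex off the right side is determined by its index up to an
error of at most one. -/
theorem stairDrawing_fst_bounds (t : StairVertex m) :
    (∃ i, t = v i) ∨
      -(stairGap m t.index + 1) ≤ stairDrawing m t 0 ∧ stairDrawing m t 0 ≤ -stairGap m t.index := by
  cases t with
  | v i => exact .inl ⟨i, rfl⟩
  | w i => rw [stairDrawing_w_fst]; exact .inr ⟨le_rfl, by simp [index]⟩
  | z i => rw [stairDrawing_z_fst]; exact .inr ⟨by simp [index], le_rfl⟩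
  | u i => rw [stairDrawing_u_fst]; exact .inr ⟨le_rfl, by simp [index]⟩

theorem StairVertex.index_le (t : StairVertex m) : t.index ≤ m := by
  cases t <;> simp only [index] <;> omega

theorem StairVertex.row_le (t : StairVertex m) : t.row ≤ m := by
  cases t <;> simp only [row] <;> omega

/-- The index of the target decides: right for larger indices and for the v's, left otherwise. In
the last row the left neighbour is u_{m-1}, and no other vertex off the right side has index m. -/
theorem stairDrawing_closer_from_z (i : Fin (m + 1)) (t : StairVertex m) (ht : z i ≠ t) :
    ∃ c, (staircase m).graph.Adj (z i) c ∧
      dist (stairDrawing m c) (stairDrawing m t) <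
        dist (stairDrawing m (z i)) (stairDrawing m t) := by
  have hK := four_le_stairGap m i
  have hright : -stairGap m i < 2 * stairDrawing m t 0 → ∃ c, (staircase m).graph.Adj (z i) c ∧
      dist (stairDrawing m c) (stairDrawing m t) <
        dist (stairDrawing m (z i)) (stairDrawing m t) := fun h =>
    stairDrawing_closer_right (.zv i) (by
      rw [stairDrawing_z_fst, stairDrawing_v_fst]; linarith)
  rcases stairDrawing_fst_bounds t with ⟨k, rfl⟩ | ⟨hl, hu⟩
  · exact hright (by rw [stairDrawing_v_fst]; linarith)
  have htm := t.index_le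
  have hKt := four_le_stairGap m t.index
  rcases lt_trichotomy (i : ℕ) t.index with h | h | h
  · exact hright (by linarith [stairGap_lt h htm])
  · cases i using Fin.lastCases with
    | last =>
      cases t with
      | v k => simp [stairDrawing_v_fst] at hu; linarith
      | w k => simp [index] at h; omega
      | z k => exact absurd (by rw [Fin.ext h]) ht
      | u k => simp [index] at h; omega
    | cast i =>
      refine stairDrawing_closer_left (.wz i) ?_
      rw [stairDrawing_z_fst, stairDrawing_w_fst]
      simp only [Fin.val_castSucc] at h ⊢
      cases t with
      | v k => simp [stairDrawing_v_fst] at hu; linarith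
      | w k => rw [stairDrawing_w_fst, h]; simp only [index]; linarith
      | z k => exact absurd (by rw [Fin.ext (show (i.castSucc : ℕ) = k from h)]) ht
      | u k => rw [stairDrawing_u_fst, h]; simp only [index]; linarith
  · have hlt := stairGap_lt (m := m) h (by omega)
    cases i using Fin.lastCases with
    | last =>
      have hm : m - 1 < m := by simp at h; omega
      refine stairDrawing_closer_left (.uz ⟨m - 1, hm⟩ (by simp; omega)) ?_
      rw [stairDrawing_z_fst, stairDrawing_u_fst]
      have h1 := stairGap_succ (m := m) (i := m - 1) (by omega)
      rw [Nat.sub_add_cancel (by omega)] at h1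
      have h2 := stairGap_le (m := m) (i := t.index) (j := m - 1) (by simp at h; omega) (by omega)
      simp only [Fin.val_last] at hK ⊢
      linarith
    | cast i =>
      refine stairDrawing_closer_left (.wz i) ?_
      rw [stairDrawing_z_fst, stairDrawing_w_fst]
      simp only [Fin.val_castSucc] at hlt hK ⊢
      linarith

/-- Targets of larger index and the v's are reached by stepping right, those of smaller index by
stepping left to u_{i-1}. The same index leaves z_i to the right and u_i above. -/
theorem stairDrawing_closer_from_w (i : Fin m) (t : StairVertex m) (ht : w i ≠ t) :
    ∃ c, (staircase m).graph.Adj (w i) c ∧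
      dist (stairDrawing m c) (stairDrawing m t) <
        dist (stairDrawing m (w i)) (stairDrawing m t) := by
  have hK := four_le_stairGap m i
  have hright : -(2 * stairGap m i + 1) < 2 * stairDrawing m t 0 →
      ∃ c, (staircase m).graph.Adj (w i) c ∧
      dist (stairDrawing m c) (stairDrawing m t) <
        dist (stairDrawing m (w i)) (stairDrawing m t) := fun h =>
    stairDrawing_closer_right (.wz i) (by
      rw [stairDrawing_z_fst, stairDrawing_w_fst, Fin.val_castSucc]; linarith)
  rcases stairDrawing_fst_bounds t with ⟨k, rfl⟩ | ⟨hl, hu⟩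
  · exact hright (by rw [stairDrawing_v_fst]; linarith)
  have htm := t.index_le
  have hKt := four_le_stairGap m t.index
  rcases lt_trichotomy (i : ℕ) t.index with h | h | h
  · exact hright (by linarith [stairGap_lt h htm])
  · cases t with
    | v k => simp [stairDrawing_v_fst] at hu; linarith
    | w k => exact absurd (by rw [Fin.ext h]) ht
    | z k => exact hright (by rw [stairDrawing_z_fst, h]; simp only [index]; linarith)
    | u k => exact stairDrawing_closer_up (.wu i) (by simp only [row, index] at h ⊢; omega)
  · obtain ⟨j, hj⟩ : ∃ j : Fin m, (i : ℕ) = j + 1 := ⟨⟨i - 1, by omega⟩, by simp; omega⟩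
    refine stairDrawing_closer_left (.uw j i hj) ?_
    rw [stairDrawing_w_fst, stairDrawing_u_fst]
    have h1 := stairGap_succ (m := m) (i := j) (by omega)
    have h2 := stairGap_le (m := m) (i := t.index) (j := j) (by omega) (by omega)
    rw [hj] at hK ⊢
    linarith

/-- Any other target off the right side with index at most i lies in row at most i, so stepping down
gains; all remaining targets are to the right. -/
theorem stairDrawing_closer_from_u (i : Fin m) (t : StairVertex m) (ht : u i ≠ t) :
    ∃ c, (staircase m).graph.Adj (u i) c ∧
      dist (stairDrawing m c) (stairDrawing m t) <
        dist (stairDrawing m (u i)) (stairDrawing m t) := by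
  have hK := four_le_stairGap m (i + 1)
  have hsucc := stairGap_succ (m := m) (i := i) (by omega)
  have hright : -(stairGap m i + 1 + stairGap m (i + 1)) < 2 * stairDrawing m t 0 →
      ∃ c, (staircase m).graph.Adj (u i) c ∧
      dist (stairDrawing m c) (stairDrawing m t) <
        dist (stairDrawing m (u i)) (stairDrawing m t) := by
    intro h
    refine stairDrawing_closer_right (stairRight_next i) ?_
    have hn : stairDrawing m (next i) 0 ≤ -stairGap m (i + 1) := by
      rcases stairDrawing_fst_bounds (next i) with ⟨k, hk⟩ | ⟨-, hu⟩
      · unfold next at hk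
        split_ifs at hk
      · have hidx : (next i).index = i + 1 := by
          unfold next
          split_ifs
          · rfl
          · simp [index]; omega
        rwa [hidx] at hu
    rw [stairDrawing_u_fst]
    linarith
  rcases stairDrawing_fst_bounds t with ⟨k, rfl⟩ | ⟨hl, hu⟩
  · exact hright (by rw [stairDrawing_v_fst]; linarith)
  have htm := t.index_le
  rcases lt_or_ge (i : ℕ) t.index with h | h
  · exact hright (by linarith [stairGap_le (m := m) (i := i + 1) h htm])
  · refine stairDrawing_closer_down (.wu i) ?_
    cases t with
    | v k =>
      simp only [stairDrawing_v_fst] at hu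
      linarith [four_le_stairGap m (v k : StairVertex m).index]
    | w k => simp only [row, index] at h ⊢; omega
    | z k => simp only [row, index] at h ⊢; omega
    | u k =>
      simp only [row, index, ne_eq, u.injEq, Fin.ext_iff] at h ht ⊢
      omega

theorem stairDrawing_closer_from_v (i : Fin (m + 1)) (t : StairVertex m) (ht : v i ≠ t) :
    ∃ c, (staircase m).graph.Adj (v i) c ∧
      dist (stairDrawing m c) (stairDrawing m t) <
        dist (stairDrawing m (v i)) (stairDrawing m t) := by
  have htm := t.row_le
  rcases lt_trichotomy (i : ℕ) t.row with h | h | h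
  · obtain ⟨j, rfl⟩ : ∃ j : Fin m, i = j.castSucc := ⟨⟨i, by omega⟩, rfl⟩
    exact stairDrawing_closer_up (.vv j) h
  · refine stairDrawing_closer_left (.zv i) ?_
    have hK := four_le_stairGap m i
    rw [stairDrawing_v_fst, stairDrawing_z_fst]
    cases t with
    | v k => exact absurd (by rw [Fin.ext h]) ht
    | w k => rw [stairDrawing_w_fst, ← show (i : ℕ) = k from h]; linarith
    | z k => rw [stairDrawing_z_fst, ← show (i : ℕ) = k from h]; linarith
    | u k =>
      have := stairGap_le (m := m) (i := k) (j := i) (by simp only [row] at h; omega) (by omega)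
      rw [stairDrawing_u_fst]
      linarith
  · obtain ⟨j, rfl⟩ : ∃ j : Fin m, i = j.succ :=
      ⟨⟨i - 1, by omega⟩, Fin.ext (by simp; omega)⟩
    exact stairDrawing_closer_down (.vv j) h

theorem stairDrawing_isGreedyDrawing (m : ℕ) :
    (staircase m).IsGreedyDrawing (stairDrawing m) := by
  refine OrientedShape.isGreedyDrawing_of_exists_adj_closer (stairDrawing_isDrawing m) ?_
  rintro (i | i | i | i) t ht
  · exact stairDrawing_closer_from_v i t ht
  · exact stairDrawing_closer_from_w i t ht
  · exact stairDrawing_closer_from_z i t ht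
  · exact stairDrawing_closer_from_u i t ht

end GreedyDrawing

/-! ### Faces of an arbitrary drawing. -/

section Convexity

open StairVertex

variable {m : ℕ} {p : StairVertex m → Plane}

theorem connectedComponentIn_eq_of_separated {α : Type*} [TopologicalSpace α] {S A B : Set α}
    {x : α} (hS : S = A ∪ B) (hA : IsOpen A) (hB : IsOpen B) (hAB : Disjoint A B)
    (hconn : IsPreconnected A) (hx : x ∈ A) : connectedComponentIn S x = A := by
  have hxS : x ∈ S := hS ▸ .inl hx
  refine Set.Subset.antisymm ?_ (hconn.subset_connectedComponentIn hx (hS ▸ Set.subset_union_left))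
  exact isPreconnected_connectedComponentIn.subset_left_of_subset_union hA hB hAB
    (hS ▸ connectedComponentIn_subset S x) ⟨x, mem_connectedComponentIn hxS, hx⟩

theorem Plane.continuous_coord (i : Fin 2) : Continuous fun P : Plane => P i := by
  fun_prop

theorem Plane.convex_setOf_coord {s : Set ℝ} (hs : Convex ℝ s) (i : Fin 2) :
    Convex ℝ {P : Plane | P i ∈ s} :=
  hs.linear_preimage (EuclideanSpace.proj (𝕜 := ℝ) i).toLinearMap

theorem Plane.abs_coord_le_norm (P : Plane) (i : Fin 2) : |P i| ≤ ‖P‖ := by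
  simpa using PiLp.norm_apply_le P i

theorem Plane.norm_le (P : Plane) : ‖P‖ ≤ |P 0| + |P 1| := by
  rw [EuclideanSpace.norm_eq, Fin.sum_univ_two]
  refine Real.sqrt_le_iff.2 ⟨by positivity, ?_⟩
  simp only [Real.norm_eq_abs]
  nlinarith [abs_nonneg (P 0), abs_nonneg (P 1)]

/-- The open rectangle between the rows `i` and `i + 1` of a drawing of the staircase. -/
def innerRect (p : StairVertex m → Plane) (i : Fin m) : Set Plane :=
  {P | p (w i) 0 < P 0 ∧ P 0 < p (v 0) 0 ∧ p (v i.castSucc) 1 < P 1 ∧ P 1 < p (v i.succ) 1}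

/-- The region enclosed by a drawing of the staircase. -/
def region (p : StairVertex m → Plane) : Set Plane :=
  {P | ∃ i : Fin m, p (w i) 0 ≤ P 0 ∧ P 0 ≤ p (v 0) 0 ∧ p (v i.castSucc) 1 ≤ P 1 ∧
    P 1 ≤ p (v i.succ) 1}

theorem staircase_w_zero_le (hp : (staircase m).IsDrawing p) (hm : 0 < m) (i : Fin m) :
    p (w ⟨0, hm⟩) 0 ≤ p (w i) 0 := by
  obtain ⟨i, hi⟩ := i
  induction i with
  | zero => rfl
  | succ i ih => exact (ih (by omega)).trans (staircase_w_lt_w hp rfl).le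

theorem staircase_w_lt_v (hp : (staircase m).IsDrawing p) (i : Fin m) :
    p (w i) 0 < p (v 0) 0 :=
  (staircase_w_lt_z_castSucc hp i).trans (staircase_z_lt_v hp _)

/-- As the left sides move right going up, the lower bound of each rectangle may be dropped: a point
too low for rectangle i+1 is still right of the left side of rectangle i. -/
theorem mem_region_iff (hp : (staircase m).IsDrawing p) {P : Plane} :
    P ∈ region p ↔ P 0 ≤ p (v 0) 0 ∧ p (v 0) 1 ≤ P 1 ∧
      ∃ i : Fin m, p (w i) 0 ≤ P 0 ∧ P 1 ≤ p (v i.succ) 1 := by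
  constructor
  · rintro ⟨i, h1, h2, h3, h4⟩
    exact ⟨h2, ((staircase_v_snd_strictMono hp).monotone (Fin.zero_le _)).trans h3, i, h1, h4⟩
  · rintro ⟨hX, h0, ⟨i, hi⟩, hw, hP⟩
    induction i with
    | zero => exact ⟨_, hw, hX, h0, hP⟩
    | succ i ih =>
      rcases le_total (p (v (Fin.castSucc ⟨i + 1, hi⟩)) 1) (P 1) with h | h
      · exact ⟨_, hw, hX, h, hP⟩
      · exact ih (by omega) ((staircase_w_lt_w hp rfl).le.trans hw) h

theorem drawn_of_right (hp : (staircase m).IsDrawing p) {a b : StairVertex m}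
    (h : StairRight m a b) {P : Plane} (h1 : P 1 = p a 1) (ha : p a 0 ≤ P 0)
    (hb : P 0 ≤ p b 0) : P ∈ (staircase m).drawn p := by
  have hab := hp.right_edge a b h
  exact ⟨a, b, staircase_adj_of_right h,
    (Plane.mem_segment_of_snd_eq hab.1 hab.2).2 ⟨h1, ha, hb⟩⟩

theorem drawn_of_up (hp : (staircase m).IsDrawing p) {a b : StairVertex m}
    (h : StairUp m a b) {P : Plane} (h0 : P 0 = p a 0) (ha : p a 1 ≤ P 1)
    (hb : P 1 ≤ p b 1) : P ∈ (staircase m).drawn p := by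
  have hab := hp.up_edge a b h
  exact ⟨a, b, staircase_adj_of_up h,
    (Plane.mem_segment_of_fst_eq hab.1 hab.2).2 ⟨h0, ha, hb⟩⟩

theorem drawn_of_z_le (hp : (staircase m).IsDrawing p) (i : Fin (m + 1)) {P : Plane}
    (h1 : P 1 = p (v i) 1) (h : p (z i) 0 ≤ P 0) (hX : P 0 ≤ p (v 0) 0) :
    P ∈ (staircase m).drawn p :=
  drawn_of_right hp (.zv i) (h1.trans (staircase_z_snd hp i).symm) h
    (hX.trans_eq (staircase_v_fst hp i).symm)

theorem drawn_of_w_le (hp : (staircase m).IsDrawing p) (i : Fin m) {P : Plane}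
    (h1 : P 1 = p (v i.castSucc) 1) (h : p (w i) 0 ≤ P 0) (hX : P 0 ≤ p (v 0) 0) :
    P ∈ (staircase m).drawn p := by
  rcases le_total (P 0) (p (z i.castSucc) 0) with h' | h'
  · exact drawn_of_right hp (.wz i) (h1.trans (staircase_w_snd hp i).symm) h h'
  · exact drawn_of_z_le hp _ h1 h' hX

theorem drawn_of_u_le (hp : (staircase m).IsDrawing p) (i : Fin m) {P : Plane}
    (h1 : P 1 = p (v i.succ) 1) (h : p (w i) 0 ≤ P 0) (hX : P 0 ≤ p (v 0) 0) :
    P ∈ (staircase m).drawn p := by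
  rcases le_total (P 0) (p (next i) 0) with h' | h'
  · exact drawn_of_right hp (stairRight_next i) (h1.trans (staircase_u_snd hp i).symm)
      ((staircase_u_fst hp i).trans_le h) h'
  · unfold next at h'
    split_ifs at h' with hi
    · exact drawn_of_w_le hp ⟨i + 1, hi⟩ h1 h' hX
    · have hl : i.succ = Fin.last m := Fin.ext (by simp; omega)
      rw [hl] at h1
      exact drawn_of_z_le hp _ h1 h' hX

theorem notMem_innerRect_of_row (hp : (staircase m).IsDrawing p) {P : Plane} {r : Fin (m + 1)}
    (h : P 1 = p (v r) 1) (k : Fin m) : P ∉ innerRect p k := by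
  rintro ⟨-, -, h1, h2⟩
  rw [h] at h1 h2
  have h1' := (staircase_v_snd_strictMono hp).lt_iff_lt.1 h1
  have h2' := (staircase_v_snd_strictMono hp).lt_iff_lt.1 h2
  simp only [Fin.lt_def, Fin.val_castSucc, Fin.val_succ] at h1' h2'
  omega

theorem right_segment_subset (hp : (staircase m).IsDrawing p) (hm : 1 ≤ m) {a b : StairVertex m}
    (h : StairRight m a b) {P : Plane} (hP : P ∈ segment ℝ (p a) (p b)) :
    P ∈ region p ∧ ∀ i, P ∉ innerRect p i := by
  have hab := hp.right_edge a b h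
  rw [Plane.mem_segment_of_snd_eq hab.1 hab.2] at hP
  obtain ⟨h1, h2, h3⟩ := hP
  have hlt : ∀ i : Fin m, p (v i.castSucc) 1 < p (v i.succ) 1 := fun i =>
    (hp.up_edge _ _ (.vv i)).2
  have hu : ∀ i : Fin m, p (w i) 0 ≤ P 0 → P 0 ≤ p (v 0) 0 → P 1 = p (v i.succ) 1 →
      P ∈ region p ∧ ∀ i, P ∉ innerRect p i := fun i hl hr hs =>
    ⟨⟨i, hl, hr, (hlt i).le.trans_eq hs.symm, hs.le⟩, notMem_innerRect_of_row hp hs⟩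
  have hw : ∀ i : Fin m, p (w i) 0 ≤ P 0 → P 0 ≤ p (v 0) 0 → P 1 = p (v i.castSucc) 1 →
      P ∈ region p ∧ ∀ i, P ∉ innerRect p i := fun i hl hr hs =>
    ⟨⟨i, hl, hr, hs.ge, hs.trans_le (hlt i).le⟩, notMem_innerRect_of_row hp hs⟩
  cases h with
  | uw i j h =>
    exact hu i ((staircase_u_fst hp i).symm.trans_le h2) (h3.trans (staircase_w_lt_v hp j).le)
      (h1.trans (staircase_u_snd hp i))
  | uz i h =>
    exact hu i ((staircase_u_fst hp i).symm.trans_le h2) (h3.trans (staircase_z_lt_v hp _).le)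
      (h1.trans (staircase_u_snd hp i))
  | wz i =>
    exact hw i h2 (h3.trans (staircase_z_lt_v hp _).le) (h1.trans (staircase_w_snd hp i))
  | zv i =>
    rw [staircase_v_fst hp] at h3
    rw [staircase_z_snd hp] at h1
    cases i using Fin.lastCases with
    | cast i => exact hw i ((staircase_w_lt_z_castSucc hp i).le.trans h2) h3 h1
    | last =>
      have hl : Fin.last m = (⟨m - 1, by omega⟩ : Fin m).succ := Fin.ext (by simp; omega)
      rw [hl] at h1 h2
      exact hu _ ((staircase_w_lt_z_succ hp _).le.trans h2) h3 h1

theorem up_segment_subset (hp : (staircase m).IsDrawing p) {a b : StairVertex m}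
    (h : StairUp m a b) {P : Plane} (hP : P ∈ segment ℝ (p a) (p b)) :
    P ∈ region p ∧ ∀ i, P ∉ innerRect p i := by
  have hab := hp.up_edge a b h
  rw [Plane.mem_segment_of_fst_eq hab.1 hab.2] at hP
  obtain ⟨h1, h2, h3⟩ := hP
  cases h with
  | vv i =>
    rw [staircase_v_fst hp] at h1
    exact ⟨⟨i, (staircase_w_lt_v hp i).le.trans_eq h1.symm, h1.le, h2, h3⟩,
      fun k hk => hk.2.1.ne h1⟩
  | wu i =>
    rw [staircase_w_snd hp] at h2
    rw [staircase_u_snd hp] at h3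
    refine ⟨⟨i, h1.ge, h1.trans_le (staircase_w_lt_v hp i).le, h2, h3⟩, ?_⟩
    rintro k ⟨hk, -, hk1, hk2⟩
    have h1' := (staircase_v_snd_strictMono hp).lt_iff_lt.1 (hk1.trans_le h3)
    have h2' := (staircase_v_snd_strictMono hp).lt_iff_lt.1 (h2.trans_lt hk2)
    simp only [Fin.lt_def, Fin.val_castSucc, Fin.val_succ] at h1' h2'
    obtain rfl : k = i := Fin.ext (by omega)
    exact hk.ne h1.symm

theorem mem_drawn_iff (hp : (staircase m).IsDrawing p) (hm : 1 ≤ m) {P : Plane} :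
    P ∈ (staircase m).drawn p ↔ P ∈ region p ∧ ∀ i, P ∉ innerRect p i := by
  constructor
  · rintro ⟨a, b, hab, hP⟩
    rcases (OrientedShape.graph_adj.1 hab).2 with (h | h) | (h | h)
    · exact right_segment_subset hp hm h hP
    · exact up_segment_subset hp h hP
    · exact right_segment_subset hp hm h (segment_symm ℝ (p a) (p b) ▸ hP)
    · exact up_segment_subset hp h (segment_symm ℝ (p a) (p b) ▸ hP)
  · rintro ⟨⟨i, h1, h2, h3, h4⟩, hi⟩
    rcases h1.eq_or_lt with h1' | h1'
    · exact drawn_of_up hp (.wu i) h1'.symm ((staircase_w_snd hp i).trans_le h3)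
        (h4.trans_eq (staircase_u_snd hp i).symm)
    rcases h2.eq_or_lt with h2' | h2'
    · exact drawn_of_up hp (.vv i) (h2'.trans (staircase_v_fst hp _).symm) h3 h4
    rcases h3.eq_or_lt with h3' | h3'
    · exact drawn_of_w_le hp i h3'.symm h1 h2
    rcases h4.eq_or_lt with h4' | h4'
    · exact drawn_of_u_le hp i h4' h1 h2
    exact absurd ⟨h1', h2', h3', h4'⟩ (hi i)

theorem isOpen_innerRect (i : Fin m) : IsOpen (innerRect p i) :=
  (isOpen_lt continuous_const (Plane.continuous_coord 0)).inter
    ((isOpen_lt (Plane.continuous_coord 0) continuous_const).inter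
      ((isOpen_lt continuous_const (Plane.continuous_coord 1)).inter
        (isOpen_lt (Plane.continuous_coord 1) continuous_const)))

theorem isClosed_region : IsClosed (region p) := by
  have : region p = ⋃ i : Fin m, {P | p (w i) 0 ≤ P 0 ∧ P 0 ≤ p (v 0) 0 ∧
      p (v i.castSucc) 1 ≤ P 1 ∧ P 1 ≤ p (v i.succ) 1} := by
    ext P
    simp [region]
  rw [this]
  exact isClosed_iUnion_of_finite fun i =>
    (isClosed_le continuous_const (Plane.continuous_coord 0)).inter
      ((isClosed_le (Plane.continuous_coord 0) continuous_const).inter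
        ((isClosed_le continuous_const (Plane.continuous_coord 1)).inter
          (isClosed_le (Plane.continuous_coord 1) continuous_const)))

theorem convex_innerRect (i : Fin m) : Convex ℝ (innerRect p i) := by
  have h0 := Plane.convex_setOf_coord (convex_Ioo (𝕜 := ℝ) (p (w i) 0) (p (v 0) 0)) 0
  have h1 := Plane.convex_setOf_coord
    (convex_Ioo (𝕜 := ℝ) (p (v i.castSucc) 1) (p (v i.succ) 1)) 1
  convert h0.inter h1 using 1
  ext P
  simp [innerRect, and_assoc]

theorem isBounded_innerRect (i : Fin m) : Bornology.IsBounded (innerRect p i) := by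
  refine isBounded_iff_forall_norm_le.2 ⟨(|p (w i) 0| + |p (v 0) 0|) +
    (|p (v i.castSucc) 1| + |p (v i.succ) 1|), ?_⟩
  rintro P ⟨h1, h2, h3, h4⟩
  have bound : ∀ a b c : ℝ, a < b → b < c → |b| ≤ |a| + |c| := by
    intro a b c hab hbc
    refine abs_le.2 ⟨?_, ?_⟩
    · linarith [neg_abs_le a, abs_nonneg c]
    · linarith [le_abs_self c, abs_nonneg a]
  exact (Plane.norm_le P).trans (add_le_add (bound _ _ _ h1 h2) (bound _ _ _ h3 h4))

theorem innerRect_subset_region (i : Fin m) : innerRect p i ⊆ region p :=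
  fun _ h => ⟨i, h.1.le, h.2.1.le, h.2.2.1.le, h.2.2.2.le⟩

theorem disjoint_innerRect (hp : (staircase m).IsDrawing p) {i j : Fin m} (hij : i ≠ j) :
    Disjoint (innerRect p i) (innerRect p j) := by
  refine Set.disjoint_left.2 ?_
  rintro P ⟨-, -, h1, h2⟩ ⟨-, -, h3, h4⟩
  have h1' := (staircase_v_snd_strictMono hp).lt_iff_lt.1 (h1.trans h4)
  have h2' := (staircase_v_snd_strictMono hp).lt_iff_lt.1 (h3.trans h2)
  simp only [Fin.lt_def, Fin.val_castSucc, Fin.val_succ] at h1' h2'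
  exact hij (Fin.ext (by omega))

theorem setOf_snd_lt_subset (hp : (staircase m).IsDrawing p) :
    {P : Plane | P 1 ∈ Set.Iio (p (v 0) 1)} ⊆ (region p)ᶜ := fun _ hP hR =>
  absurd ((mem_region_iff hp).1 hR).2.1 (not_le.2 hP)

/-- The half-plane below meets those to the left and to the right. By `mem_region_iff`, a point
outside that is neither below nor to the right has its whole leftward ray outside, and that ray
reaches the left half-plane. -/
theorem isPreconnected_compl_region (hp : (staircase m).IsDrawing p) (hm : 0 < m) :
    IsPreconnected (region p)ᶜ := by
  let X : ℝ := p (v 0) 0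
  let x₀ : ℝ := p (w ⟨0, hm⟩) 0
  let y₀ : ℝ := p (v 0) 1
  have below := (Plane.convex_setOf_coord (convex_Iio (𝕜 := ℝ) y₀) 1).isPreconnected
  have right := (Plane.convex_setOf_coord (convex_Ioi (𝕜 := ℝ) X) 0).isPreconnected
  have left := (Plane.convex_setOf_coord (convex_Iio (𝕜 := ℝ) x₀) 0).isPreconnected
  have hleft : {P : Plane | P 0 ∈ Set.Iio x₀} ⊆ (region p)ᶜ := by
    intro P hP hR
    obtain ⟨-, -, i, hi, -⟩ := (mem_region_iff hp).1 hR
    have := staircase_w_zero_le hp hm i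
    exact absurd (this.trans hi) (not_le.2 hP)
  have hright : {P : Plane | P 0 ∈ Set.Ioi X} ⊆ (region p)ᶜ := fun P hP hR =>
    absurd ((mem_region_iff hp).1 hR).1 (not_le.2 hP)
  have hbelow : {P : Plane | P 1 ∈ Set.Iio y₀} ⊆ (region p)ᶜ := setOf_snd_lt_subset hp
  have hbl : (!₂[x₀ - 1, y₀ - 1] : Plane) ∈ {P : Plane | P 1 ∈ Set.Iio y₀} := by simp
  refine isPreconnected_of_forall (!₂[x₀ - 1, y₀ - 1] : Plane) fun P hP => ?_
  by_cases h1 : P 1 < y₀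
  · exact ⟨_, hbelow, hbl, h1, below⟩
  by_cases h2 : X < P 0
  · exact ⟨_, Set.union_subset hright hbelow, .inr hbl, .inl h2,
      right.union (!₂[X + 1, y₀ - 1] : Plane) (by simp) (by simp) below⟩
  have ray := ((Plane.convex_setOf_coord (convex_Iic (𝕜 := ℝ) (P 0)) 0).inter
    (Plane.convex_setOf_coord (convex_singleton (𝕜 := ℝ) (P 1)) 1)).isPreconnected
  refine ⟨_, Set.union_subset ?_ hleft, ?_, ?_,
    ray.union (!₂[min (P 0) (x₀ - 1), P 1] : Plane) (by simp) (by simp) left⟩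
  rotate_left
  · exact .inr (by simp)
  · exact .inl ⟨le_refl (P 0), rfl⟩
  rintro Q ⟨hQ0, hQ1⟩ hR
  have hQ1' : Q 1 = P 1 := hQ1
  obtain ⟨-, -, i, hi, hi'⟩ := (mem_region_iff hp).1 hR
  exact hP ((mem_region_iff hp).2 ⟨not_lt.1 h2, not_lt.1 h1, i, hi.trans hQ0, hQ1' ▸ hi'⟩)

theorem not_isBounded_compl_region (hp : (staircase m).IsDrawing p) :
    ¬ Bornology.IsBounded (region p)ᶜ := by
  intro h
  obtain ⟨C, hC⟩ := isBounded_iff_forall_norm_le.1 (h.subset (setOf_snd_lt_subset hp))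
  let y : ℝ := min (p (v 0) 1) (-C) - 1
  have h1 := hC (!₂[0, y] : Plane) (by
    show y < _
    linarith [min_le_left (p (v 0) 1) (-C)])
  have h2 : |y| ≤ ‖(!₂[0, y] : Plane)‖ := Plane.abs_coord_le_norm (!₂[0, y] : Plane) 1
  have h3 := neg_abs_le y
  have h4 : y ≤ -C - 1 := by linarith [min_le_right (p (v 0) 1) (-C)]
  linarith

theorem combo_mem_Icc {x y a b : ℝ} (hxy : x ≤ y) (ha : 0 ≤ a) (hb : 0 ≤ b) (hab : a + b = 1) :
    x ≤ a * x + b * y ∧ a * x + b * y ≤ y := by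
  obtain rfl : a = 1 - b := by linarith
  constructor <;> nlinarith

/-- In `mem_region_iff` only the existential condition is not inherited from both ends for free, and
it becomes harder to the left and upwards. Hence on a vertical line the witness of the upper end
serves the whole segment, on a horizontal line that of the left end. -/
theorem convex_region_line (hp : (staircase m).IsDrawing p) (t : ℝ) (k : Fin 2) :
    Convex ℝ {P : Plane | P ∈ region p ∧ P k = t} := by
  have key : ∀ P Q : Plane, P ∈ region p → Q ∈ region p → P k = Q k → P 0 ≤ Q 0 → P 1 ≤ Q 1 →
      ∀ R : Plane, (∀ l, P l ≤ R l ∧ R l ≤ Q l) → R ∈ region p := by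
    intro P Q hP hQ hk h0 h1 R hR
    rw [mem_region_iff hp] at hP hQ ⊢
    obtain ⟨-, hP1, i, hi, hi'⟩ := hP
    obtain ⟨hQ0, -, j, hj, hj'⟩ := hQ
    refine ⟨(hR 0).2.trans hQ0, hP1.trans (hR 1).1, ?_⟩
    fin_cases k
    · exact ⟨j, hj.trans (hk.ge.trans (hR 0).1), (hR 1).2.trans hj'⟩
    · exact ⟨i, hi.trans (hR 0).1, (hR 1).2.trans (hk.ge.trans hi')⟩
  have main : ∀ P Q : Plane, P ∈ region p → Q ∈ region p → P k = Q k → P 0 ≤ Q 0 → P 1 ≤ Q 1 →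
      ∀ a b : ℝ, 0 ≤ a → 0 ≤ b → a + b = 1 → a • P + b • Q ∈ region p := by
    intro P Q hP hQ hk h0 h1 a b ha hb hab
    refine key P Q hP hQ hk h0 h1 _ fun l => ?_
    refine combo_mem_Icc ?_ ha hb hab
    fin_cases l
    · exact h0
    · exact h1
  rintro P ⟨hP, hPt⟩ Q ⟨hQ, hQt⟩ a b ha hb hab
  have hk : P k = Q k := hPt.trans hQt.symm
  refine ⟨?_, ?_⟩
  · have hcmp : (P 0 ≤ Q 0 ∧ P 1 ≤ Q 1) ∨ (Q 0 ≤ P 0 ∧ Q 1 ≤ P 1) := by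
      fin_cases k
      · exact (le_total (P 1) (Q 1)).imp (fun h => ⟨hk.le, h⟩) (fun h => ⟨hk.ge, h⟩)
      · exact (le_total (P 0) (Q 0)).imp (fun h => ⟨h, hk.le⟩) (fun h => ⟨h, hk.ge⟩)
    rcases hcmp with ⟨h0, h1⟩ | ⟨h0, h1⟩
    · exact main P Q hP hQ hk h0 h1 a b ha hb hab
    · rw [add_comm]
      exact main Q P hQ hP hk.symm h0 h1 b a hb ha (by linarith)
  · show a * P k + b * Q k = t
    rw [hPt, hQt, ← add_mul, hab, one_mul]

theorem staircase_isConvex (hm : 1 ≤ m) : (staircase m).IsConvex := by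
  rintro p hp F ⟨P, hP, rfl⟩
  -- The complement of the drawing splits into disjoint open connected sets, the exterior and the
  -- inner rectangles, so these are its components.
  have hS : ((staircase m).drawn p)ᶜ = (region p)ᶜ ∪ ⋃ i, innerRect p i := by
    ext Q
    rw [Set.mem_compl_iff, mem_drawn_iff hp hm]
    simp only [Set.mem_union, Set.mem_compl_iff, Set.mem_iUnion, not_and_or, not_forall, not_not]
  rcases id (hS ▸ hP : P ∈ (region p)ᶜ ∪ ⋃ i, innerRect p i) with hP' | hP'
  · have hF : connectedComponentIn ((staircase m).drawn p)ᶜ P = (region p)ᶜ := by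
      refine connectedComponentIn_eq_of_separated hS isClosed_region.isOpen_compl
        (isOpen_iUnion isOpen_innerRect) ?_ (isPreconnected_compl_region hp hm) hP'
      rw [Set.disjoint_compl_left_iff_subset]
      exact Set.iUnion_subset innerRect_subset_region
    rw [hF]
    refine ⟨fun h => absurd h (not_isBounded_compl_region hp), fun _ t => ?_⟩
    simp only [Set.mem_compl_iff, not_not]
    exact ⟨convex_region_line hp t 0, convex_region_line hp t 1⟩
  · obtain ⟨i, hi⟩ := Set.mem_iUnion.1 hP'
    have hF : connectedComponentIn ((staircase m).drawn p)ᶜ P = innerRect p i := by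
      have hS' : ((staircase m).drawn p)ᶜ =
          innerRect p i ∪ ((region p)ᶜ ∪ ⋃ j : {j // j ≠ i}, innerRect p j) := by
        rw [hS]
        ext Q
        simp only [Set.mem_union, Set.mem_compl_iff, Set.mem_iUnion, Subtype.exists]
        constructor
        · rintro (h | ⟨j, hj⟩)
          · exact .inr (.inl h)
          · by_cases hji : j = i
            · exact .inl (hji ▸ hj)
            · exact .inr (.inr ⟨j, hji, hj⟩)
        · rintro (h | h | ⟨j, -, hj⟩)
          · exact .inr ⟨i, h⟩
          · exact .inl h
          · exact .inr ⟨j, hj⟩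
      refine connectedComponentIn_eq_of_separated hS' (isOpen_innerRect i)
        (isClosed_region.isOpen_compl.union (isOpen_iUnion fun j => isOpen_innerRect _)) ?_
        (convex_innerRect i).isPreconnected hi
      rw [Set.disjoint_union_right, Set.disjoint_compl_right_iff_subset,
        Set.disjoint_iUnion_right]
      exact ⟨innerRect_subset_region i, fun j => disjoint_innerRect hp j.2.symm⟩
    rw [hF]
    refine ⟨fun _ => ⟨_, _, _, _, staircase_w_lt_v hp i, (hp.up_edge _ _ (.vv i)).2, rfl⟩,
      fun h => absurd (isBounded_innerRect i) h⟩

end Convexity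

theorem mainTheorem7 :
    ∃ c : ℝ, 0 < c ∧ ∀ m : ℕ, 1 ≤ m →
      Nat.card (StairVertex m) = 4 * m + 2 ∧
      (staircase m).IsRectilinearRepresentation ∧
      (staircase m).graph.IsBiconnected ∧
      (staircase m).IsConvex ∧
      (staircase m).Dx.IsSeriesParallel ∧
      (staircase m).Dy.IsSeriesParallel ∧
      (∃ p : StairVertex m → Plane, (staircase m).IsGreedyDrawing p ∧ OnIntegerGrid p) ∧
      (∀ p : StairVertex m → Plane, (staircase m).IsGreedyDrawing p →
        (∀ i j : Fin m, (j : ℕ) = i + 1 →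
          2 * (p (.v 0) 0 - p (.w j) 0) < p (.v 0) 0 - p (.z i.castSucc) 0) ∧
        (∀ i : Fin m, (i : ℕ) + 1 = m →
          2 * (p (.v 0) 0 - p (.z i.succ) 0) < p (.v 0) 0 - p (.z i.castSucc) 0 ∨
          2 * (p (.v 0) 0 - p (.z i.castSucc) 0) < p (.v 0) 0 - p (.z i.succ) 0)) ∧
      (∀ p : StairVertex m → Plane, (staircase m).IsGreedyDrawing p →
        (∀ a b : StairVertex m, a ≠ b → 1 ≤ dist (p a) (p b)) →
        (2 : ℝ) ^ (c * (Nat.card (StairVertex m) : ℝ)) ≤ drawingArea p) := by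
  -- With n = 4m + 2, the inequality n/6 ≤ m is equivalent to m ≥ 1.
  refine ⟨1 / 6, by norm_num, fun m hm => ⟨StairVertex.natCard m,
    ⟨staircase_connected m, _, stairDrawing_isDrawing m⟩, staircase_isBiconnected hm,
    staircase_isConvex hm, staircase_Dx_isSeriesParallel, staircase_Dy_isSeriesParallel hm,
    ⟨_, stairDrawing_isGreedyDrawing m, stairDrawing_onIntegerGrid m⟩,
    fun p hp => ⟨fun i j hij => greedy_two_mul_w_lt_z hp hij, greedy_last_rows hp⟩,
    fun p hp h1 => le_trans ?_ (greedy_two_pow_le_drawingArea hm hp h1)⟩⟩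
  rw [StairVertex.natCard, ← Real.rpow_natCast]
  refine Real.rpow_le_rpow_of_exponent_le (by norm_num) ?_
  have : (1 : ℝ) ≤ m := by exact_mod_cast hm
  push_cast
  linarith
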